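/- A \emph{marked graph diagram} is a link diagram in the plane $\mathbb R^2$ in which, besides crossings, finitely many marked vertices are allowed: 4-valent vertices with a short bar, the marker, lying in two opposite ones of the four sectors around the vertex. It is \emph{oriented} if every edge is oriented so that around each marked vertex edges pointing towards the vertex alternate with edges pointing away from it. Diagrams are considered up to plane isotopy; they may be empty or disconnected, and simple closed curves are allowed. A move replaces a piece of an oriented diagram inside a disc by another piece with the same oriented ends; it may be used in both directions. In the pictures below vertices and crossings are drawn as the letter X, with four legs SW, SE, NW, NE, and a marker is a horizontal bar (in the left and right sectors) or a vertical bar (in the bottom and top sectors). The oriented Yoshikawa moves considered are the following. (I) Removing a kink: $\Gamma_1$ (positive crossing, loop running clockwise), $\Gamma_1'$ (positive crossing, loop running anticlockwise), $\Gamma_{1a}$ (negative crossing, loop running clockwise). (II) Pulling apart two vertical strands that cross twice, the strand with its ends on the left lying over the other one: $\Gamma_2$ (both strands point up), $\Gamma_{2b}$ (left strand up, right strand down), $\Gamma_{2c}$ (left strand down, right strand up). (III) Passing the bottom strand of three pairwise crossing strands across the crossing of the other two. $\Gamma_3$: the top strand runs from the top right to the bottom left, the middle strand from the top left to the bottom right,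 and the bottom strand, vertical and pointing up, passes from the left to the right of their crossing (the central triangle is cyclically oriented). $\Gamma_{3a}$: $\sigma_1\sigma_2\sigma_1\leftrightarrow\sigma_2\sigma_1\sigma_2$ with all three strands pointing up and all three crossings positive. (IV) $\Gamma_4$, $\Gamma_4'$: at a vertex with horizontal marker, whose legs SW, NE point towards it and whose legs NW, SE point away from it, a strand running from left to right below the vertex, across the legs SW and SE, is moved above the vertex, across the legs NW and NE; the strand lies over these legs in $\Gamma_4$ and under them in $\Gamma_4'$. (V) $\Gamma_5$: a crossing and, on its right, a vertex with horizontal marker, such that the legs SE, NE of the crossing are joined to the legs SW, NW of the vertex, respectively, are replaced by a vertex with horizontal marker and, on its right, a crossing, joined in the same way. The crossing is positive, both its strands run downwards, the free ends at the bottom left and bottom right point outwards, and those at the top left and top right point inwards (this determines all orientations). (VI) $\Gamma_6$, $\Gamma_6'$: let a vertex have legs SW, NE pointing towards it and legs NW, SE pointing away from it, and let SE be joined to NE by an arc on the right that forms an empty loop (which runs anticlockwise). The vertex with the loop is replaced by a simple strand from SW to NW. The marker is vertical in $\Gamma_6$ and horizontal in $\Gamma_6'$. (VII) $\Gamma_7$: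 on three vertical strands pointing up, down, up, a vertex with vertical marker on the first and second strand, with a vertex with horizontal marker on the second and third strand above it, is replaced by the same two vertices with the second one below the first one. (VIII) $\Gamma_8$: four strands point, at the bottom from left to right, up, down, up, down. The first two run parallel to the upper right, the last two parallel to the upper left, and the two pairs cross in four crossings, the first pair lying over the second one. Above these crossings, the two strands that are now on the left meet in a vertex with vertical marker, and the two that are now on the right meet in a vertex with horizontal marker. The move changes all four crossings, so that the first pair lies under the second one. Let $$\mathfrak S_1=\{\Gamma_1,\Gamma_1',\Gamma_2,\Gamma_3,\Gamma_4,\Gamma_4',\Gamma_5,\Gamma_6,\Gamma_6',\Gamma_7,\Gamma_8\},$$ $$\mathfrak S_2=\{\Gamma_1,\Gamma_{1a},\Gamma_{2b},\Gamma_{2c},\Gamma_{3a},\Gamma_4,\Gamma_4',\Gamma_5,\Gamma_6,\Gamma_6',\Gamma_7,\Gamma_8\}.$$ A move $\Gamma$ is \emph{realized} by a set $T$ of moves if any two oriented marked graph diagrams that differ by one application of $\Gamma$ are related by a finite sequence of plane isotopies and moves in $T$ (in either direction); otherwise $\Gamma$ is \emph{independent} from the moves in $T$. \textbf{Corollary.}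 For every $\Gamma\in\mathfrak S_1\setminus\{\Gamma_5,\Gamma_8\}$, the move $\Gamma$ is independent from the moves in $\mathfrak S_1\setminus\{\Gamma\}$. For every $\Gamma\in\mathfrak S_2\setminus\{\Gamma_5,\Gamma_8\}$, the move $\Gamma$ is independent from the moves in $\mathfrak S_2\setminus\{\Gamma\}$. -/

import Mathlib

/-!
Oriented marked graph diagrams in the plane, plane isotopy, and oriented Yoshikawa moves.

A diagram is put in general position with respect to the height function of the plane and read
from bottom to top: it is a finite sequence of layers, each of which consists of vertical strands
and one elementary piece (a local minimum, a local maximum, a crossing, a marked vertex).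
Two such sequences describe plane isotopic diagrams if and only if they are related by the moves
`IsotopyRule` below (exchange of heights, cancellation of a minimum against a maximum, and a
double point or marked vertex passing a local extremum of one of its two branches).
-/

namespace Yoshikawa

/-- The direction of an oriented strand where it meets a horizontal line. -/
inductive Dir
  | up
  | down
  deriving DecidableEq

/-- The opposite direction. -/
def Dir.op : Dir → Dir
  | .up => .down
  | .down => .up

/-- Which branch of a crossing (drawn as the letter X) is the over-strand: `rising` is the branch
from bottom left to top right, `falling` the branch from top left to bottom right. -/
inductive Over
  | rising
  | falling
  deriving DecidableEq

/-- The effect of a quarter turn of the plane on a crossing. -/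
def Over.turn : Over → Over
  | .rising => .falling
  | .falling => .rising

/-- The marker of a marked vertex (drawn as the letter X): a short horizontal or vertical bar
through the vertex. -/
inductive Marker
  | horizontal
  | vertical
  deriving DecidableEq

/-- The effect of a quarter turn of the plane on a marker. -/
def Marker.turn : Marker → Marker
  | .horizontal => .vertical
  | .vertical => .horizontal

/-- Elementary pieces of an oriented marked graph diagram.
* `cup d`: a local minimum; its left end has direction `d`, its right end the opposite one.
* `cap d`: a local maximum; its left end has direction `d`, its right end the opposite one.
* `cross o d e`: a crossing; the rising branch has direction `d`, the falling one direction `e`.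
* `vertex m d`: a marked vertex with marker `m`.  Its two left edges have direction `d` and its two
  right edges the opposite direction, so that, around the vertex, edges pointing towards it
  alternate with edges pointing away from it. -/
inductive Piece
  | cup (d : Dir)
  | cap (d : Dir)
  | cross (o : Over) (d e : Dir)
  | vertex (m : Marker) (d : Dir)
  deriving DecidableEq

/-- The directions of the lower ends of a piece, from left to right. -/
def Piece.bot : Piece → List Dir
  | .cup _ => []
  | .cap d => [d, d.op]
  | .cross _ d e => [d, e]
  | .vertex _ d => [d, d.op]

/-- The directions of the upper ends of a piece, from left to right. -/
def Piece.top : Piece → List Dir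
  | .cup d => [d, d.op]
  | .cap _ => []
  | .cross _ d e => [e, d]
  | .vertex _ d => [d, d.op]

/-- A horizontal layer: vertical strands `left`, one elementary piece, vertical strands `right`. -/
structure Layer where
  left : List Dir
  piece : Piece
  right : List Dir
  deriving DecidableEq

/-- The strands at the bottom of a layer. -/
def Layer.bot (L : Layer) : List Dir := L.left ++ L.piece.bot ++ L.right

/-- The strands at the top of a layer. -/
def Layer.top (L : Layer) : List Dir := L.left ++ L.piece.top ++ L.right

/-- Put the vertical strands `l` to the left and `r` to the right of a layer. -/
def Layer.pad (l r : List Dir) (L : Layer) : Layer := ⟨l ++ L.left, L.piece, L.right ++ r⟩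

/-- `Fits u T v`: the layers in `T`, stacked from bottom to top, fit together and form a tangle
with strands `u` at the bottom and strands `v` at the top. -/
def Fits : List Dir → List Layer → List Dir → Prop
  | u, [], v => u = v
  | u, L :: T, v => L.bot = u ∧ Fits L.top T v

/-- An oriented marked graph diagram in the plane (in general position with respect to height). -/
structure Diagram where
  layers : List Layer
  fits : Fits [] layers []

/-- A local modification: a tangle that is replaced, and the tangle that replaces it. -/
abbrev Rule := List Layer × List Layer

/-- `D'` is obtained from `D` by replacing, in one place, the first tangle of the rule `ρ` by the
second; the rest of the diagram is unchanged. -/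
def Applies (ρ : Rule) (D D' : Diagram) : Prop :=
  ∃ (below above : List Layer) (l r : List Dir),
    D.layers = below ++ ρ.1.map (Layer.pad l r) ++ above ∧
    D'.layers = below ++ ρ.2.map (Layer.pad l r) ++ above

/-- The rules that generate plane isotopy. -/
inductive IsotopyRule : Rule → Prop
  /-- Two pieces side by side exchange their heights. -/
  | exchange (p q : Piece) (m : List Dir) :
      IsotopyRule ([⟨[], p, m ++ q.bot⟩, ⟨p.top ++ m, q, []⟩],
        [⟨p.bot ++ m, q, []⟩, ⟨[], p, m ++ q.top⟩])
  /-- A maximum cancels against a minimum on its right. -/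
  | zigzag_right (d : Dir) :
      IsotopyRule ([⟨[d], .cup d.op, []⟩, ⟨[], .cap d, [d]⟩], [])
  /-- A maximum cancels against a minimum on its left. -/
  | zigzag_left (d : Dir) :
      IsotopyRule ([⟨[], .cup d, [d]⟩, ⟨[d], .cap d.op, []⟩], [])
  /-- A crossing passes a maximum of one of its branches. -/
  | cross_cap (o : Over) (d e : Dir) :
      IsotopyRule ([⟨[d], .cross o e d.op, []⟩, ⟨[], .cap d, [e]⟩],
        [⟨[], .cross o.turn d e, [d.op]⟩, ⟨[e], .cap d, []⟩])
  /-- A crossing passes a minimum of one of its branches. -/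
  | cross_cup (o : Over) (d e : Dir) :
      IsotopyRule ([⟨[], .cup d, [e]⟩, ⟨[d], .cross o d.op e, []⟩],
        [⟨[e], .cup d, []⟩, ⟨[], .cross o.turn e d, [d.op]⟩])
  /-- A marked vertex passes a maximum of one of its branches. -/
  | vertex_cap (m : Marker) (d : Dir) :
      IsotopyRule ([⟨[d.op], .vertex m d, []⟩, ⟨[], .cap d.op, [d.op]⟩],
        [⟨[], .vertex m.turn d.op, [d.op]⟩, ⟨[d.op], .cap d, []⟩])
  /-- A marked vertex passes a minimum of one of its branches. -/
  | vertex_cup (m : Marker) (d : Dir) :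
      IsotopyRule ([⟨[], .cup d, [d]⟩, ⟨[d], .vertex m d.op, []⟩],
        [⟨[d], .cup d.op, []⟩, ⟨[], .vertex m.turn d, [d]⟩])

/-- Names of the oriented Yoshikawa moves that occur in the generating sets `𝔖₁` and `𝔖₂`. -/
inductive Move
  | Γ1 | Γ1' | Γ1a
  | Γ2 | Γ2b | Γ2c
  | Γ3 | Γ3a
  | Γ4 | Γ4'
  | Γ5
  | Γ6 | Γ6'
  | Γ7
  | Γ8
  deriving DecidableEq

open Dir Over Marker Piece in
/-- The two sides of each oriented Yoshikawa move.
* `Γ1`, `Γ1'`: a kink with a positive crossing, whose loop runs clockwise in `Γ1` and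
  anticlockwise in `Γ1'`.  `Γ1a`: a kink with a negative crossing and a clockwise loop.
* `Γ2`: two strands with the same direction.  `Γ2b`, `Γ2c`: two strands with opposite directions.
* `Γ3`: the central triangle has a cyclic orientation.  `Γ3a`: it has not, and all three crossings
  are positive.
* `Γ4`, `Γ4'`: a strand passes over, respectively under, a marked vertex.
* `Γ5`: a crossing passes through a marked vertex.
* `Γ6`, `Γ6'`: a loop at a marked vertex is removed; the marker separates the loop from the rest
  of the diagram in `Γ6` and points towards the loop in `Γ6'`.
* `Γ7`: two marked vertices with a common edge are exchanged.
* `Γ8`: of two pairs of strands that come from two marked vertices, the one that lies over the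
  other one is made to lie under it. -/
def Move.rule : Move → Rule
  | Γ1 => ([⟨[up], cup up, []⟩, ⟨[], cross rising up up, [down]⟩, ⟨[up], cap up, []⟩], [])
  | Γ1' => ([⟨[down], cup down, []⟩, ⟨[], cross rising down down, [up]⟩,
      ⟨[down], cap down, []⟩], [])
  | Γ1a => ([⟨[up], cup up, []⟩, ⟨[], cross falling up up, [down]⟩, ⟨[up], cap up, []⟩], [])
  | Γ2 => ([⟨[], cross rising up up, []⟩, ⟨[], cross falling up up, []⟩], [])
  | Γ2b => ([⟨[], cross rising up down, []⟩, ⟨[], cross falling down up, []⟩], [])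
  | Γ2c => ([⟨[], cross rising down up, []⟩, ⟨[], cross falling up down, []⟩], [])
  | Γ3 =>
    ([⟨[], cross rising down up, [down]⟩, ⟨[up], cross rising down down, []⟩,
        ⟨[], cross falling up down, [down]⟩],
      [⟨[down], cross falling up down, []⟩, ⟨[], cross rising down down, [up]⟩,
        ⟨[down], cross rising down up, []⟩])
  | Γ3a =>
    ([⟨[], cross rising up up, [up]⟩, ⟨[up], cross rising up up, []⟩,
        ⟨[], cross rising up up, [up]⟩],
      [⟨[up], cross rising up up, []⟩, ⟨[], cross rising up up, [up]⟩,
        ⟨[up], cross rising up up, []⟩])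
  | Γ4 =>
    ([⟨[], cross rising up up, [down]⟩, ⟨[up], cross rising up down, []⟩,
        ⟨[], vertex horizontal up, [up]⟩],
      [⟨[up], vertex horizontal up, []⟩, ⟨[], cross rising up up, [down]⟩,
        ⟨[up], cross rising up down, []⟩])
  | Γ4' =>
    ([⟨[], cross falling up up, [down]⟩, ⟨[up], cross falling up down, []⟩,
        ⟨[], vertex horizontal up, [up]⟩],
      [⟨[up], vertex horizontal up, []⟩, ⟨[], cross falling up up, [down]⟩,
        ⟨[up], cross falling up down, []⟩])
  | Γ5 =>
    ([⟨[down], cup down, [down]⟩, ⟨[], cross rising down down, [up, down]⟩,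
        ⟨[down, down], vertex horizontal up, []⟩, ⟨[down], cap down, [down]⟩],
      [⟨[down], cup up, [down]⟩, ⟨[], vertex horizontal down, [down, down]⟩,
        ⟨[down, up], cross rising down down, []⟩, ⟨[down], cap up, [down]⟩])
  | Γ6 => ([⟨[up], cup down, []⟩, ⟨[], vertex vertical up, [up]⟩, ⟨[up], cap down, []⟩], [])
  | Γ6' => ([⟨[up], cup down, []⟩, ⟨[], vertex horizontal up, [up]⟩, ⟨[up], cap down, []⟩], [])
  | Γ7 =>
    ([⟨[], vertex vertical up, [up]⟩, ⟨[up], vertex horizontal down, []⟩],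
      [⟨[up], vertex horizontal down, []⟩, ⟨[], vertex vertical up, [up]⟩])
  | Γ8 =>
    ([⟨[up], cross rising down up, [down]⟩, ⟨[], cross rising up up, [down, down]⟩,
        ⟨[up, up], cross rising down down, []⟩, ⟨[up], cross rising up down, [down]⟩,
        ⟨[], vertex vertical up, [up, down]⟩, ⟨[up, down], vertex horizontal up, []⟩],
      [⟨[up], cross falling down up, [down]⟩, ⟨[], cross falling up up, [down, down]⟩,
        ⟨[up, up], cross falling down down, []⟩, ⟨[up], cross falling up down, [down]⟩,
        ⟨[], vertex vertical up, [up, down]⟩, ⟨[up, down], vertex horizontal up, []⟩])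

/-- One step: a plane isotopy or one of the moves in `T`, in one direction. -/
def Step (T : Set Move) (D D' : Diagram) : Prop :=
  (∃ ρ, IsotopyRule ρ ∧ Applies ρ D D') ∨ ∃ M ∈ T, Applies M.rule D D'

/-- `D` and `D'` are related by a finite sequence of plane isotopies and moves in `T`, each of them
performed in either direction. -/
def Related (T : Set Move) : Diagram → Diagram → Prop := Relation.EqvGen (Step T)

/-- The move `M` is realized by `T`: whenever two diagrams differ by one move `M`, they are related
by a finite sequence of plane isotopies and moves in `T`. -/
def Move.RealizedBy (M : Move) (T : Set Move) : Prop :=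
  ∀ D D' : Diagram, Applies M.rule D D' → Related T D D'

/-- The move `M` is independent from the moves in `T`: it cannot be realized by them. -/
def Move.IndependentFrom (M : Move) (T : Set Move) : Prop := ¬ M.RealizedBy T

open Move in
/-- The generating set `𝔖₁` of oriented Yoshikawa moves. -/
def S1 : Set Move := {Γ1, Γ1', Γ2, Γ3, Γ4, Γ4', Γ5, Γ6, Γ6', Γ7, Γ8}

open Move in
/-- The generating set `𝔖₂` of oriented Yoshikawa moves. -/
def S2 : Set Move := {Γ1, Γ1a, Γ2b, Γ2c, Γ3a, Γ4, Γ4', Γ5, Γ6, Γ6', Γ7, Γ8}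

end Yoshikawa

namespace Yoshikawa

/-! Each independence is proved by an invariant: a quantity unchanged by plane isotopy and by all
moves of `T`, but with different values on one explicit pair of closed diagrams that differ by the
remaining move. Invariance is checked locally, by reading a diagram as a composition of operators on
functions of the colours of the strands (`Reading`), or by inspecting pieces or regions.

State sums (`StateSum`) smooth every marked vertex, with a weight `phi` on the colours of the two
arcs, and treat crossings as signs, scalars or shifts of colours. `kink` compares crossing signs
with rotation and detects Γ1, Γ1', Γ1a. `triple` notices a crossing of two components passing over a
third, which only Γ3 and Γ3a allow. `slide` uses a vertex weight that is not invariant under shifts,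
for Γ4 and Γ4'. `swap` uses one for which Γ7 fails.

Products of signs settle three more moves: the parity of the negative crossings for Γ2, and the
parity of the number of components of a resolution for Γ6 and Γ6'.

The two opposite-direction second moves of `S2` need finer invariants. Γ2b can create a region whose
Alexander index exceeds those of its neighbours, so the condition that no index is positive detects
it. For Γ2c, diagrams are coloured by a self-distributive operation with injective but not
surjective translations: Γ2b costs nothing, while Γ2c imposes a solvability condition, which can
destroy every colouring that uses both parities. -/

instance Fits.decidable : ∀ u T v, Decidable (Fits u T v)
  | u, [], v => inferInstanceAs (Decidable (u = v))
  | u, L :: T, v =>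
    have := Fits.decidable L.top T v
    inferInstanceAs (Decidable (L.bot = u ∧ Fits L.top T v))

/-- A quantity that is unchanged by plane isotopies and by the moves in `T`, but not by `M`, shows
that `M` is independent from `T`. -/
theorem Move.independentFrom_of_invariant {α : Type*} {M : Move} {T : Set Move} (I : Diagram → α)
    (hiso : ∀ ρ, IsotopyRule ρ → ∀ D D', Applies ρ D D' → I D = I D')
    (hmove : ∀ N ∈ T, ∀ D D', Applies N.rule D D' → I D = I D')
    (below above : List Layer) (l r : List Dir)
    (h₁ : Fits [] (below ++ M.rule.1.map (Layer.pad l r) ++ above) [])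
    (h₂ : Fits [] (below ++ M.rule.2.map (Layer.pad l r) ++ above) [])
    (hne : I ⟨_, h₁⟩ ≠ I ⟨_, h₂⟩) : M.IndependentFrom T := by
  intro h
  refine hne ?_
  have key := h ⟨_, h₁⟩ ⟨_, h₂⟩ ⟨below, above, l, r, rfl, rfl⟩
  generalize (⟨_, h₁⟩ : Diagram) = D at key
  generalize (⟨_, h₂⟩ : Diagram) = D' at key
  induction key with
  | rel x y h =>
    rcases h with ⟨ρ, hρ, ha⟩ | ⟨N, hN, ha⟩
    · exact hiso ρ hρ _ _ ha
    · exact hmove N hN _ _ ha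
  | refl x => rfl
  | symm x y _ ih => exact ih.symm
  | trans x y z _ _ ih₁ ih₂ => exact ih₁.trans ih₂

theorem Fits.append {u v : List Dir} {S T : List Layer} (h : Fits u (S ++ T) v) :
    ∃ w, Fits u S w ∧ Fits w T v := by
  induction S generalizing u with
  | nil => exact ⟨u, rfl, h⟩
  | cons L S ih =>
    obtain ⟨h₁, h₂⟩ := h
    obtain ⟨w, hw₁, hw₂⟩ := ih h₂
    exact ⟨w, ⟨h₁, hw₁⟩, hw₂⟩

/-! ### Invariants from operators on functions of colours. -/

/-- Read from the top, a diagram acts on functions of the colours of the strands at a horizontal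
line. `act` is the action of a piece without strands on its left, `push` records, in a context of
type `K`, the strands on the left, and `rel` says which values are not to be distinguished. -/
structure Reading (X R K : Type*) where
  push : K → Dir → X → K
  act : Piece → K → (List X → R) → List X → R
  rel : K → List X → R → R → Prop
  rel_cons : ∀ k d x u a b, rel k (x :: u) a b ↔ rel (push k d x) u a b
  act_congr : ∀ (p : Piece) k (n : ℕ) (f g : List X → R),
    (∀ v : List X, v.length = p.top.length + n → rel k v (f v) (g v)) →
    ∀ u : List X, u.length = p.bot.length + n → rel k u (act p k f u) (act p k g u)

namespace Reading

variable {X R K : Type*} (A : Reading X R K)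

/-- The action of a piece with strands on its left. -/
noncomputable def opL (p : Piece) (l : List Dir) : K → (List X → R) → List X → R :=
  List.rec (A.act p) (fun d _ g k f u =>
    List.casesOn u (f []) fun x u => g (A.push k d x) (fun v => f (x :: v)) u) l

/-- The action of a tangle. -/
noncomputable def ev (T : List Layer) (k : K) (f : List X → R) : List X → R :=
  List.rec f (fun L _ g => A.opL L.piece L.left k g) T

@[simp] theorem opL_nil (p : Piece) (k : K) (f : List X → R) : A.opL p [] k f = A.act p k f := rfl

@[simp] theorem opL_cons (p : Piece) (d : Dir) (l : List Dir) (k : K) (f : List X → R) (x : X)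
    (u : List X) :
    A.opL p (d :: l) k f (x :: u) = A.opL p l (A.push k d x) (fun v => f (x :: v)) u := rfl

@[simp] theorem ev_nil (k : K) (f : List X → R) : A.ev [] k f = f := rfl

@[simp] theorem ev_cons (L : Layer) (T : List Layer) (k : K) (f : List X → R) :
    A.ev (L :: T) k f = A.opL L.piece L.left k (A.ev T k f) := rfl

theorem ev_append (S T : List Layer) (k : K) (f : List X → R) :
    A.ev (S ++ T) k f = A.ev S k (A.ev T k f) := by
  induction S with
  | nil => rfl
  | cons L S ih => simp [ih]

theorem opL_congr (p : Piece) (l : List Dir) (k : K) (n : ℕ) (f g : List X → R)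
    (h : ∀ v : List X, v.length = l.length + (p.top.length + n) → A.rel k v (f v) (g v))
    (u : List X) (hu : u.length = l.length + (p.bot.length + n)) :
    A.rel k u (A.opL p l k f u) (A.opL p l k g u) := by
  induction l generalizing k f g u with
  | nil =>
    exact A.act_congr p k n f g (fun v hv => h v (by simpa using hv)) u (by simpa using hu)
  | cons d l ih =>
    cases u with
    | nil => simp at hu; omega
    | cons x u =>
      rw [A.rel_cons k d]
      refine ih _ _ _ (fun v hv => ?_) u (by simp at hu; omega)
      rw [← A.rel_cons k d]
      exact h _ (by simp; omega)

theorem ev_congr {s t : List Dir} {T : List Layer} (hT : Fits s T t) (k : K) {f g : List X → R}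
    (h : ∀ v : List X, v.length = t.length → A.rel k v (f v) (g v))
    (u : List X) (hu : u.length = s.length) : A.rel k u (A.ev T k f u) (A.ev T k g u) := by
  induction T generalizing s u with
  | nil => exact h u (hu.trans (congrArg _ hT))
  | cons L T ih =>
    obtain ⟨h₁, h₂⟩ := hT
    refine A.opL_congr _ _ k L.right.length _ _ (fun v hv => ih h₂ v ?_) u ?_
    · simp [Layer.top]; omega
    · rw [hu, ← h₁]; simp [Layer.bot]

theorem ev_pad_nil (T : List Layer) (r : List Dir) (k : K) (f : List X → R) :
    A.ev (T.map (Layer.pad [] r)) k f = A.ev T k f := by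
  induction T with
  | nil => rfl
  | cons L T ih => simp [ih, Layer.pad]

theorem ev_pad_cons (T : List Layer) (d : Dir) (l r : List Dir) (k : K) (f : List X → R) (x : X)
    (u : List X) :
    A.ev (T.map (Layer.pad (d :: l) r)) k f (x :: u) =
      A.ev (T.map (Layer.pad l r)) (A.push k d x) (fun v => f (x :: v)) u := by
  induction T generalizing u with
  | nil => rfl
  | cons L T ih =>
    simp only [List.map_cons, ev_cons, Layer.pad, List.cons_append, opL_cons]
    congr 1
    funext v
    exact ih v

/-- The two sides of a rule act in the same way. -/
def Sound (ρ : Rule) : Prop :=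
  ∃ L T, ρ.1 = L :: T ∧ ∀ k f (u : List X), L.bot.length ≤ u.length →
    A.rel k u (A.ev ρ.1 k f u) (A.ev ρ.2 k f u)

theorem Sound.pad {ρ : Rule} {L : Layer}
    (h : ∀ k f (u : List X), L.bot.length ≤ u.length →
      A.rel k u (A.ev ρ.1 k f u) (A.ev ρ.2 k f u))
    (l r : List Dir) (k : K) (f : List X → R) (u : List X)
    (hu : l.length + L.bot.length ≤ u.length) :
    A.rel k u (A.ev (ρ.1.map (Layer.pad l r)) k f u) (A.ev (ρ.2.map (Layer.pad l r)) k f u) := by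
  induction l generalizing k f u with
  | nil => rw [ev_pad_nil, ev_pad_nil]; exact h k f u (by simpa using hu)
  | cons d l ih =>
    cases u with
    | nil => simp at hu
    | cons x u =>
      rw [ev_pad_cons, ev_pad_cons, A.rel_cons k d]
      exact ih _ _ _ (by simp at hu; omega)

theorem Sound.applies {ρ : Rule} (h : A.Sound ρ) {D D' : Diagram} (hD : Applies ρ D D') (k : K)
    (f : List X → R) : A.rel k [] (A.ev D.layers k f []) (A.ev D'.layers k f []) := by
  obtain ⟨L, T, hL, h⟩ := h
  obtain ⟨below, above, l, r, h₁, h₂⟩ := hD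
  have hf := D.fits
  rw [h₁, List.append_assoc] at hf
  obtain ⟨w, hw₁, hw₂⟩ := hf.append
  rw [h₁, h₂, List.append_assoc, List.append_assoc, ev_append, ev_append, ev_append, ev_append]
  -- That the layers of `D` fit together guarantees enough strands below the replaced tangle.
  refine A.ev_congr hw₁ k (fun v hv => Sound.pad A h l r k _ v ?_) [] rfl
  rw [hL] at hw₂
  obtain ⟨hw₂, -⟩ := hw₂
  rw [hv, ← hw₂]
  simp [Layer.bot, Layer.pad]

end Reading

/-! ### State sums and their invariance under plane isotopy. -/

/-- The sign that counts a strand pointing up positively. -/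
def Dir.sign : Dir → ℤ
  | .up => 1
  | .down => -1

@[simp] theorem Dir.sign_op (d : Dir) : d.op.sign = -d.sign := by cases d <;> rfl

@[simp] theorem Dir.op_op (d : Dir) : d.op.op = d := by cases d <;> rfl

/-- Weights of a state sum over the colourings of the strands of a diagram by the elements of `X`.
A strand that passes below, respectively above, a strand of colour `x` is shifted by `below x`,
respectively `above x`. The weight of a crossing depends on the number of strands on its left, where
strands of colour `x` are counted `chi x` times, on its sign, and on the colours of the over- and
the under-strand. -/
structure StateSum (X R : Type*) [CommRing R] where
  cupW : Dir → R
  capW : Dir → R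
  phi : X → X → R
  shift : ℤ → X → X
  below : X → ℤ
  above : X → ℤ
  chi : X → ℤ
  weight : ℤ → Bool → X → X → R
  cup_cap : ∀ d, cupW d.op * capW d = 1
  phi_symm : ∀ x y, phi x y = phi y x
  shift_zero : ∀ x, shift 0 x = x
  shift_add : ∀ m n x, shift (m + n) x = shift m (shift n x)
  below_shift : ∀ n x, below (shift n x) = below x
  above_shift : ∀ n x, above (shift n x) = above x
  chi_shift : ∀ n x, chi (shift n x) = chi x
  shift_below : ∀ x, shift (below x) x = x
  shift_above : ∀ x, shift (above x) x = x
  weight_shift_left : ∀ k s n x y, weight k s (shift n x) y = weight k s x y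
  weight_shift_right : ∀ k s n x y, weight k s x (shift n y) = weight k s x y
  weight_chi_left : ∀ k s n x y, weight (k + n * chi x) s x y = weight k s x y
  weight_chi_right : ∀ k s n x y, weight (k + n * chi y) s x y = weight k s x y
  weight_mul : ∀ k x y, weight k true x y * weight k false x y = 1

namespace StateSum

attribute [simp] shift_zero below_shift above_shift chi_shift weight_shift_left weight_shift_right

variable {X R : Type*} [CommRing R] (A : StateSum X R)

theorem shift_neg_shift (n : ℤ) (x : X) : A.shift (-n) (A.shift n x) = x := by
  rw [← A.shift_add]; simp

theorem shift_shift_neg (n : ℤ) (x : X) : A.shift n (A.shift (-n) x) = x := by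
  rw [← A.shift_add]; simp

/-- The shift as a permutation of the colours. -/
def shiftEquiv (n : ℤ) : X ≃ X :=
  ⟨A.shift n, A.shift (-n), A.shift_neg_shift n, A.shift_shift_neg n⟩

@[simp] theorem shiftEquiv_apply (n : ℤ) (x : X) : A.shiftEquiv n x = A.shift n x := rfl

variable [Fintype X] [DecidableEq X]

/-- The linear action of a piece. -/
def act : Piece → ℤ → (List X → R) → List X → R
  | .cup d, _, f, u => A.cupW d * ∑ c, f (c :: c :: u)
  | .cap d, _, f, a :: b :: u => if a = b then A.capW d * f u else 0
  | .cross .rising d e, k, f, a :: b :: u =>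
    A.weight k (d = e) a b *
      f (A.shift (d.sign * A.below a) b :: A.shift (e.sign * A.above b) a :: u)
  | .cross .falling d e, k, f, a :: b :: u =>
    A.weight k (d ≠ e) b a *
      f (A.shift (-(d.sign * A.above a)) b :: A.shift (-(e.sign * A.below b)) a :: u)
  -- A vertical marker is smoothed to two vertical strands, a horizontal one to a maximum below a
  -- minimum; `phi` couples the two resulting arcs.
  | .vertex .vertical _, _, f, a :: b :: u => A.phi a b * f (a :: b :: u)
  | .vertex .horizontal d, _, f, a :: b :: u =>
    if a = b then A.capW d * A.cupW d * ∑ c, A.phi a c * f (c :: c :: u) else 0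
  | _, _, _, _ => 0

/-- The reading of diagrams by a state sum. -/
def reading : Reading X R ℤ where
  push k d x := k + d.sign * A.chi x
  act := A.act
  rel _ _ := Eq
  rel_cons _ _ _ _ _ _ := Iff.rfl
  act_congr p k n f g h u hu := by
    match p, u with
    | .cup d, u => simp [act]; congr 1; refine Finset.sum_congr rfl fun c _ => h _ ?_
                   simp_all [Piece.top, Piece.bot]; omega
    | .cap d, a :: b :: u =>
      simp only [act]; split_ifs
      · rw [h]; simp_all [Piece.top, Piece.bot]; omega
      · rfl
    | .cross .rising d e, a :: b :: u =>
      simp only [act]; rw [h]; simp_all [Piece.top, Piece.bot]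
    | .cross .falling d e, a :: b :: u =>
      simp only [act]; rw [h]; simp_all [Piece.top, Piece.bot]
    | .vertex .vertical d, a :: b :: u =>
      simp only [act]; rw [h]; simp_all [Piece.top, Piece.bot]
    | .vertex .horizontal d, a :: b :: u =>
      simp only [act]; split_ifs
      · congr 1; refine Finset.sum_congr rfl fun c _ => ?_
        rw [h]; simp_all [Piece.top, Piece.bot]
      · rfl
    | .cap _, [] | .cap _, [_] | .cross .rising _ _, [] | .cross .rising _ _, [_]
    | .cross .falling _ _, [] | .cross .falling _ _, [_]
    | .vertex .vertical _, [] | .vertex .vertical _, [_]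
    | .vertex .horizontal _, [] | .vertex .horizontal _, [_] => rfl

theorem act_mul (p : Piece) (k : ℤ) (c : R) (f : List X → R) (u : List X) :
    A.act p k (fun v => c * f v) u = c * A.act p k f u := by
  unfold act
  split <;> (try split_ifs) <;> simp [Finset.mul_sum, mul_left_comm, mul_comm, mul_assoc]

theorem act_sum (p : Piece) (k : ℤ) {ι : Type*} (s : Finset ι) (f : ι → List X → R) (u : List X) :
    A.act p k (fun v => ∑ i ∈ s, f i v) u = ∑ i ∈ s, A.act p k (f i) u := by
  unfold act
  split <;> (try split_ifs) <;> simp only [Finset.mul_sum, Finset.sum_const_zero]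
  all_goals exact Finset.sum_comm

theorem opL_mul (p : Piece) (l : List Dir) (k : ℤ) (c : R) (f : List X → R) (u : List X) :
    A.reading.opL p l k (fun v => c * f v) u = c * A.reading.opL p l k f u := by
  induction l generalizing k f u with
  | nil => exact A.act_mul p k c f u
  | cons d l ih =>
    cases u with
    | nil => rfl
    | cons x u => exact ih _ _ _

theorem opL_sum (p : Piece) (l : List Dir) (k : ℤ) {ι : Type*} (s : Finset ι)
    (f : ι → List X → R) (u : List X) :
    A.reading.opL p l k (fun v => ∑ i ∈ s, f i v) u = ∑ i ∈ s, A.reading.opL p l k (f i) u := by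
  induction l generalizing k f u with
  | nil => exact A.act_sum p k s f u
  | cons d l ih =>
    cases u with
    | nil => rfl
    | cons x u => exact ih _ _ _

theorem opL_zero (p : Piece) (l : List Dir) (k : ℤ) (u : List X) :
    A.reading.opL p l k (fun _ => 0) u = 0 := by
  simpa using A.opL_mul p l k 0 (fun _ => 0) u

@[simp] theorem reading_push (k : ℤ) (d : Dir) (x : X) :
    A.reading.push k d x = k + d.sign * A.chi x := rfl

@[simp] theorem reading_act : A.reading.act = A.act := rfl

@[simp] theorem reading_rel (k : ℤ) (u : List X) (a b : R) : A.reading.rel k u a b ↔ a = b :=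
  Iff.rfl

/-- Pieces side by side commute because their actions are linear and `p` does not change the signed
count of strands to the left of `q`: shifts preserve `chi`, and the two ends of an extremum cancel.
-/
theorem act_opL (p q : Piece) (m : List Dir) (k : ℤ) (f : List X → R) (u : List X)
    (hu : p.bot.length ≤ u.length) :
    A.act p k (A.reading.opL q (p.top ++ m) k f) u =
      A.reading.opL q (p.bot ++ m) k (A.act p k f) u := by
  match p, u, hu with
  | .cup d, u, _ =>
    have h : A.act (.cup d) k f = fun v => A.cupW d * ∑ c, f (c :: c :: v) := rfl
    simp [h, act, Piece.top, Piece.bot, opL_mul, opL_sum]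
  | .cap d, a :: b :: u, _ =>
    by_cases h : a = b
    · subst h; simp [act, Piece.top, Piece.bot, opL_mul]
    · simp [act, Piece.bot, h, opL_zero]
  | .cross .rising d e, a :: b :: u, _ =>
    simp [act, Piece.top, Piece.bot, opL_mul, add_right_comm]
  | .cross .falling d e, a :: b :: u, _ =>
    simp [act, Piece.top, Piece.bot, opL_mul, add_right_comm]
  | .vertex .vertical d, a :: b :: u, _ => simp [act, Piece.top, Piece.bot, opL_mul]
  | .vertex .horizontal d, a :: b :: u, _ =>
    by_cases h : a = b
    · subst h; simp [act, Piece.top, Piece.bot, opL_mul, opL_sum]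
    · simp [act, Piece.bot, h, opL_zero]

/-- The state sum is invariant under plane isotopy. -/
theorem sound_isotopy {ρ : Rule} (hρ : IsotopyRule ρ) : A.reading.Sound ρ := by
  cases hρ with
  | exchange p q m =>
    refine ⟨_, _, rfl, fun k f u hu => ?_⟩
    simp only [Layer.bot, List.length_append, List.length_nil] at hu
    simpa using A.act_opL p q m k f u (by omega)
  | zigzag_right d =>
    refine ⟨_, _, rfl, fun k f u hu => ?_⟩
    obtain ⟨x, u⟩ := u
    · simp [Layer.bot, Piece.bot] at hu
    · simp [act, ← mul_assoc, A.cup_cap]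
  | zigzag_left d =>
    refine ⟨_, _, rfl, fun k f u hu => ?_⟩
    obtain ⟨x, u⟩ := u
    · simp [Layer.bot, Piece.bot] at hu
    · have := A.cup_cap d.op
      simp only [Dir.op_op] at this
      simp [act, ← mul_assoc, this]
  | cross_cap o d e =>
    refine ⟨_, _, rfl, fun k f u hu => ?_⟩
    have h₁ : decide (e = d.op) = !decide (d = e) := by cases d <;> cases e <;> rfl
    have h₂ : (!decide (e = d.op)) = decide (d = e) := by cases d <;> cases e <;> rfl
    match u, hu with
    | a :: b :: c :: u, _ =>
      cases o
      · simp only [Reading.ev_cons, Reading.ev_nil, Reading.opL_cons, ne_eq, decide_not,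
          Reading.opL_nil, reading_act, act, reading_push, Over.turn, h₁, reading_rel]
        by_cases h : a = A.shift (e.sign * A.below b) c
        · subst h; simp [A.weight_chi_right, shift_neg_shift]
        · have h' : ¬ A.shift (-(e.sign * A.below b)) a = c :=
            fun h' => h (by rw [← h', shift_shift_neg])
          simp [h, h']
      · simp only [Reading.ev_cons, Reading.ev_nil, Reading.opL_cons, ne_eq, decide_not,
          Reading.opL_nil, reading_act, act, reading_push, Over.turn, h₂, reading_rel]
        by_cases h : a = A.shift (-(e.sign * A.above b)) c
        · subst h; simp [A.weight_chi_left, shift_shift_neg]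
        · have h' : ¬ A.shift (e.sign * A.above b) a = c :=
            fun h' => h (by rw [← h', shift_neg_shift])
          simp [h, h']
  | cross_cup o d e =>
    refine ⟨_, _, rfl, fun k f u hu => ?_⟩
    have h₁ : decide (d.op = e) = !decide (e = d) := by cases d <;> cases e <;> rfl
    have h₂ : (!decide (d.op = e)) = decide (e = d) := by cases d <;> cases e <;> rfl
    match u, hu with
    | a :: u, _ =>
      cases o
      · simp only [Reading.ev_cons, Reading.ev_nil, Reading.opL_cons,
          Reading.opL_nil, reading_act, act, reading_push, Over.turn, h₁, reading_rel]
        -- The sums over the colour of the minimum differ by the bijection that shifts this colour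
        -- across the strand `a`.
        refine congrArg _ (Fintype.sum_equiv (A.shiftEquiv (e.sign * A.above a)) _ _ fun c => ?_)
        simp [A.weight_chi_left, shift_neg_shift]
      · simp only [Reading.ev_cons, Reading.ev_nil, Reading.opL_cons, ne_eq, decide_not,
          Reading.opL_nil, reading_act, act, reading_push, Over.turn, h₂, reading_rel]
        refine congrArg _ (Fintype.sum_equiv (A.shiftEquiv (-(e.sign * A.below a))) _ _ fun c => ?_)
        simp [A.weight_chi_right, shift_shift_neg]
  | vertex_cap m d =>
    refine ⟨_, _, rfl, fun k f u hu => ?_⟩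
    have h := A.cup_cap d
    have h' := A.cup_cap d.op
    rw [Dir.op_op] at h'
    match u, hu with
    | a :: b :: c :: u, _ =>
      cases m <;> simp [act, Marker.turn]
      · rw [A.phi_symm b a]
        split_ifs
        · linear_combination A.phi a b * f (a :: u) * A.capW d * h'
        · rfl
      · split_ifs with hab
        · subst hab
          linear_combination - A.phi a c * f (c :: u) * A.capW d.op * h
        · rfl
  | vertex_cup m d =>
    refine ⟨_, _, rfl, fun k f u hu => ?_⟩
    have h := A.cup_cap d
    have h' := A.cup_cap d.op
    rw [Dir.op_op] at h'
    match u, hu with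
    | a :: u, _ =>
      cases m <;> simp [act, Marker.turn]
      · linear_combination (A.cupW d.op * ∑ x, A.phi a x * f (a :: x :: x :: u)) * h'
      · simp only [A.phi_symm _ a]
        linear_combination - (A.cupW d * ∑ x, A.phi a x * f (x :: x :: a :: u)) * h

end StateSum

/-! ### Conditions under which a state sum respects each move. -/

namespace StateSum

variable {X R : Type*} [CommRing R] (A : StateSum X R)

/-- `above` is constant on shift orbits, so either equality makes the shift one by the colour's own
amount, which fixes it. This and its variants show that a kink forces a single colour. -/
theorem shift_above_iff (x y : X) : A.shift (A.above y) x = y ↔ x = y := by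
  constructor
  · intro h
    have h' : A.above y = A.above x := by rw [← h, above_shift]
    rw [← h, h', A.shift_above]
  · rintro rfl; exact A.shift_above x

theorem shift_neg_above (x : X) : A.shift (-A.above x) x = x := by
  conv_lhs => rw [← A.shift_above x, above_shift, shift_neg_shift]

theorem shift_neg_below (x : X) : A.shift (-A.below x) x = x := by
  conv_lhs => rw [← A.shift_below x, below_shift, shift_neg_shift]

theorem shift_neg_below_iff (x y : X) : A.shift (-A.below y) x = y ↔ x = y := by
  constructor
  · intro h
    have h' : A.below y = A.below x := by rw [← h, below_shift]
    rw [← h, h', A.shift_neg_below]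
  · rintro rfl; exact A.shift_neg_below x

theorem shift_neg_above_iff (x y : X) : A.shift (-A.above y) x = y ↔ x = y := by
  constructor
  · intro h
    have h' : A.above y = A.above x := by rw [← h, above_shift]
    rw [← h, h', A.shift_neg_above]
  · rintro rfl; exact A.shift_neg_above x

theorem shift_inj (n : ℤ) (x y : X) : A.shift n x = A.shift n y ↔ x = y :=
  (A.shiftEquiv n).apply_eq_iff_eq

theorem weight_add_chi_left (k : ℤ) (s : Bool) (x y : X) :
    A.weight (k + A.chi x) s x y = A.weight k s x y := by
  simpa using A.weight_chi_left k s 1 x y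

theorem weight_add_chi_right (k : ℤ) (s : Bool) (x y : X) :
    A.weight (k + A.chi y) s x y = A.weight k s x y := by
  simpa using A.weight_chi_right k s 1 x y

theorem weight_mul' (k : ℤ) (x y : X) : A.weight k false x y * A.weight k true x y = 1 := by
  rw [mul_comm, A.weight_mul]

variable [Fintype X] [DecidableEq X]

theorem sound_Γ1 (h : ∀ k x, A.cupW .up * A.weight k true x x * A.capW .up = 1) :
    A.reading.Sound Move.Γ1.rule := by
  refine ⟨_, _, rfl, fun k f u hu => ?_⟩
  match u, hu with
  | a :: u, _ =>
    simp [act, Move.rule, Dir.sign, shift_above_iff, A.shift_below]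
    linear_combination f (a :: u) * h k a

theorem sound_Γ1' (h : ∀ k x, A.cupW .down * A.weight k true x x * A.capW .down = 1) :
    A.reading.Sound Move.Γ1'.rule := by
  refine ⟨_, _, rfl, fun k f u hu => ?_⟩
  match u, hu with
  | a :: u, _ =>
    simp [act, Move.rule, Dir.sign, shift_neg_above_iff, A.shift_neg_below]
    linear_combination f (a :: u) * h k a

theorem sound_Γ1a (h : ∀ k x, A.cupW .up * A.weight k false x x * A.capW .up = 1) :
    A.reading.Sound Move.Γ1a.rule := by
  refine ⟨_, _, rfl, fun k f u hu => ?_⟩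
  match u, hu with
  | a :: u, _ =>
    simp [act, Move.rule, Dir.sign, shift_neg_below_iff, A.shift_neg_above]
    linear_combination f (a :: u) * h k a

theorem sound_Γ2 : A.reading.Sound Move.Γ2.rule := by
  refine ⟨_, _, rfl, fun k f u hu => ?_⟩
  match u, hu with
  | a :: b :: u, _ =>
    simp [act, Move.rule, Dir.sign, shift_neg_shift, ← mul_assoc, A.weight_mul]

theorem sound_Γ2b : A.reading.Sound Move.Γ2b.rule := by
  refine ⟨_, _, rfl, fun k f u hu => ?_⟩
  match u, hu with
  | a :: b :: u, _ =>
    simp [act, Move.rule, Dir.sign, shift_shift_neg, shift_neg_shift, ← mul_assoc, A.weight_mul']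

theorem sound_Γ2c : A.reading.Sound Move.Γ2c.rule := by
  refine ⟨_, _, rfl, fun k f u hu => ?_⟩
  match u, hu with
  | a :: b :: u, _ =>
    simp [act, Move.rule, Dir.sign, shift_shift_neg, shift_neg_shift, ← mul_assoc, A.weight_mul']

/-- Weights must not depend on the strands to the left, since each crossing is carried across the
third strand. The shifts commute and therefore agree. -/
theorem sound_Γ3 (hw : ∀ k s x y, A.weight k s x y = A.weight 0 s x y) :
    A.reading.Sound Move.Γ3.rule := by
  refine ⟨_, _, rfl, fun k f u hu => ?_⟩
  match u, hu with
  | a :: b :: c :: u, _ =>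
    simp [act, Move.rule, Dir.sign, hw, ← A.shift_add]
    simp only [add_comm]
    ring

theorem sound_Γ3a (hw : ∀ k s x y, A.weight k s x y = A.weight 0 s x y) :
    A.reading.Sound Move.Γ3a.rule := by
  refine ⟨_, _, rfl, fun k f u hu => ?_⟩
  match u, hu with
  | a :: b :: c :: u, _ =>
    simp [act, Move.rule, Dir.sign, hw, ← A.shift_add]
    simp only [add_comm]
    ring

/-- The two crossings have opposite signs, so their weights cancel; what remains is that both arcs
of the smoothed vertex are shifted by the same amount, which `phi` must not see. -/
theorem sound_Γ4
    (h : ∀ a x y, A.phi (A.shift (A.below a) x) (A.shift (A.below a) y) = A.phi x y) :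
    A.reading.Sound Move.Γ4.rule := by
  refine ⟨_, _, rfl, fun k f u hu => ?_⟩
  match u, hu with
  | a :: b :: c :: u, _ =>
    simp [act, Move.rule, Dir.sign, shift_inj, weight_add_chi_right, shift_neg_shift]
    split_ifs with hbc
    · subst hbc
      simp only [weight_add_chi_right, shift_neg_shift]
      rw [← mul_assoc, A.weight_mul, one_mul]
      refine congrArg _ (Fintype.sum_equiv (A.shiftEquiv (A.below a)).symm _ _ fun x => ?_)
      obtain ⟨x, rfl⟩ := (A.shiftEquiv (A.below a)).surjective x
      simp only [Equiv.symm_apply_apply]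
      simp only [shiftEquiv_apply, h, ← mul_assoc]
      rw [mul_assoc (A.phi b x), A.weight_mul, mul_one]
    · rfl

theorem sound_Γ4'
    (h : ∀ a x y, A.phi (A.shift (A.above a) x) (A.shift (A.above a) y) = A.phi x y) :
    A.reading.Sound Move.Γ4'.rule := by
  refine ⟨_, _, rfl, fun k f u hu => ?_⟩
  match u, hu with
  | a :: b :: c :: u, _ =>
    have h' : ∀ x y, A.phi (A.shift (-A.above a) x) (A.shift (-A.above a) y) = A.phi x y :=
      fun x y => by rw [← h a, shift_shift_neg, shift_shift_neg]
    simp [act, Move.rule, Dir.sign, shift_inj, weight_add_chi_left]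
    split_ifs with hbc
    · subst hbc
      simp only [weight_add_chi_left, shift_shift_neg]
      rw [← mul_assoc, A.weight_mul', one_mul]
      refine congrArg _ (Fintype.sum_equiv (A.shiftEquiv (-A.above a)).symm _ _ fun x => ?_)
      obtain ⟨x, rfl⟩ := (A.shiftEquiv (-A.above a)).surjective x
      simp only [Equiv.symm_apply_apply]
      simp only [shiftEquiv_apply, h', ← mul_assoc]
      rw [mul_assoc (A.phi b x), A.weight_mul', mul_one]
    · rfl

theorem sound_Γ5
    (h : ∀ a b, A.phi b (A.shift (-A.above b) a) = A.phi a (A.shift (-A.below a) b)) :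
    A.reading.Sound Move.Γ5.rule := by
  refine ⟨_, _, rfl, fun k f u hu => ?_⟩
  match u, hu with
  | a :: b :: u, _ =>
    simp [act, Move.rule, Dir.sign]
    rw [h]
    ring

/-- Smoothing splits off an anticlockwise circle, whose colour `c` is free. In Γ6' the loop stays on
the strand, so only the diagonal of `phi` matters. -/
theorem sound_Γ6 (h : ∀ x, A.cupW .down * (∑ c, A.phi x c) * A.capW .down = 1) :
    A.reading.Sound Move.Γ6.rule := by
  refine ⟨_, _, rfl, fun k f u hu => ?_⟩
  match u, hu with
  | a :: u, _ =>
    simp [act, Move.rule, Dir.sign, ← mul_assoc]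
    rw [← Finset.sum_mul, ← Finset.sum_mul]
    linear_combination f (a :: u) * h a

theorem sound_Γ6' (h : ∀ x, A.phi x x = 1) : A.reading.Sound Move.Γ6'.rule := by
  refine ⟨_, _, rfl, fun k f u hu => ?_⟩
  match u, hu with
  | a :: u, _ =>
    simp [act, Move.rule, Dir.sign]
    have h₁ := A.cup_cap .up
    have h₂ := A.cup_cap .down
    simp only [Dir.op] at h₁ h₂
    rw [h, one_mul]
    linear_combination f (a :: u) * A.cupW .down * A.capW .up * h₂ + f (a :: u) * h₁

theorem sound_Γ7 (h : ∀ x y z, A.phi x y * A.phi y z = A.phi y z * A.phi x z) :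
    A.reading.Sound Move.Γ7.rule := by
  refine ⟨_, _, rfl, fun k f u hu => ?_⟩
  match u, hu with
  | a :: b :: c :: u, _ =>
    simp [act, Move.rule, Dir.sign]
    split_ifs
    · simp only [Finset.mul_sum]
      refine Finset.sum_congr rfl fun x _ => ?_
      linear_combination A.capW .down * A.cupW .down * f (a :: x :: x :: u) * h a b x
    · rfl

/-- The strands of a pair are antiparallel. Where `phi` does not vanish they act by the same
amounts, so all shifts and weights cancel, whichever pair lies on top. -/
theorem sound_Γ8
    (h : ∀ x y, A.phi x y ≠ 0 → A.below x = A.below y ∧ A.above x = A.above y) :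
    A.reading.Sound Move.Γ8.rule := by
  refine ⟨_, _, rfl, fun k f u hu => ?_⟩
  match u, hu with
  | a :: b :: c :: d :: u, _ =>
    simp [act, Move.rule, Dir.sign]
    simp only [shift_inj]
    split_ifs with hab
    · subst hab
      simp only [shift_shift_neg, shift_neg_shift]
      by_cases hcd : A.phi c d = 0
      · simp [hcd]
      · obtain ⟨h₁, h₂⟩ := h c d hcd
        simp only [h₁, h₂, shift_shift_neg, shift_neg_shift]
        simp only [weight_add_chi_left, weight_add_chi_right]
        simp only [← mul_assoc, weight_mul, weight_mul', one_mul]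
    · rfl

end StateSum

/-! ### Four particular state sums. -/

namespace StateSum

section

variable {X R : Type*} [Fintype X] [DecidableEq X] [CommRing R] (A : StateSum X R)

/-- The value of a state sum on a diagram. -/
noncomputable def value (T : List Layer) : R := A.reading.ev T 0 (fun _ => 1) []

theorem independentFrom {M : Move} {T : Set Move} (h : ∀ N ∈ T, A.reading.Sound N.rule)
    (below above : List Layer) (l r : List Dir)
    (h₁ : Fits [] (below ++ M.rule.1.map (Layer.pad l r) ++ above) [])
    (h₂ : Fits [] (below ++ M.rule.2.map (Layer.pad l r) ++ above) [])
    (hne : A.value (below ++ M.rule.1.map (Layer.pad l r) ++ above) ≠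
      A.value (below ++ M.rule.2.map (Layer.pad l r) ++ above)) : M.IndependentFrom T :=
  Move.independentFrom_of_invariant (fun D => A.value D.layers)
    (fun _ hρ _ _ hD => (A.sound_isotopy hρ).applies A.reading hD 0 _)
    (fun N hN _ _ hD => (h N hN).applies A.reading hD 0 _) below above l r h₁ h₂ hne

end

/-- Both markers are smoothed in the same way as a pair of strands, and the resulting circles are
counted with a factor that depends on their rotation number; a crossing has weight `α` or `α'`
according to its sign. -/
def kink (α α' : ZMod 5) (h : α * α' = 1) : StateSum Bool (ZMod 5) where
  -- Per colour, a clockwise circle counts 2 and an anticlockwise one 3, the inverse of 2. Over two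
  -- colours an anticlockwise circle gives 6 = 1, as Γ6 requires.
  cupW | .up => 2 | .down => 1
  capW | .up => 1 | .down => 3
  phi _ _ := 1
  shift _ x := x
  below _ := 0
  above _ := 0
  chi _ := 0
  weight _ s _ _ := if s then α else α'
  cup_cap d := by cases d <;> rfl
  phi_symm _ _ := rfl
  shift_zero _ := rfl
  shift_add _ _ _ := rfl
  below_shift _ _ := rfl
  above_shift _ _ := rfl
  chi_shift _ _ := rfl
  shift_below _ := rfl
  shift_above _ := rfl
  weight_shift_left _ _ _ _ _ := rfl
  weight_shift_right _ _ _ _ _ := rfl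
  weight_chi_left _ _ _ _ _ := rfl
  weight_chi_right _ _ _ _ _ := rfl
  weight_mul _ _ _ := by simpa using h

/-- Γ1 forces `α = 3`, whereas Γ1' and Γ1a both force `α = 2`; the other moves allow either value.
-/
theorem kink_sound (α α' : ZMod 5) (h : α * α' = 1) (N : Move)
    (h₁ : N = .Γ1 → α * 2 = 1) (h₁' : N = .Γ1' → α * 3 = 1) (h₁a : N = .Γ1a → α' * 2 = 1) :
    (kink α α' h).reading.Sound N.rule := by
  cases N
  · exact sound_Γ1 _ fun _ _ => by simpa [kink, mul_comm] using h₁ rfl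
  · exact sound_Γ1' _ fun _ _ => by simpa [kink, mul_comm] using h₁' rfl
  · exact sound_Γ1a _ fun _ _ => by simpa [kink, mul_comm] using h₁a rfl
  · exact sound_Γ2 _
  · exact sound_Γ2b _
  · exact sound_Γ2c _
  · exact sound_Γ3 _ fun _ _ _ _ => rfl
  · exact sound_Γ3a _ fun _ _ _ _ => rfl
  · exact sound_Γ4 _ fun _ _ _ => rfl
  · exact sound_Γ4' _ fun _ _ _ => rfl
  · exact sound_Γ5 _ fun _ _ => rfl
  · exact sound_Γ6 _ fun _ => show (1 * ∑ _ : Bool, (1 : ZMod 5)) * 3 = 1 by decide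
  · exact sound_Γ6' _ fun _ => rfl
  · exact sound_Γ7 _ fun _ _ _ => rfl
  · exact sound_Γ8 _ fun _ _ _ => ⟨rfl, rfl⟩

/-- Colourings of the components by three colours; a crossing of strands of the colours `0` and `1`
contributes a sign if an odd number of strands of colour `2` lies on its left. -/
def triple : StateSum (Fin 3) ℤ where
  cupW _ := 1
  capW _ := 1
  phi x y := if x = y then 1 else 0
  shift _ x := x
  below _ := 0
  above _ := 0
  chi x := if x = 2 then 1 else 0
  weight k _ x y := if x ≠ 2 ∧ y ≠ 2 ∧ x ≠ y ∧ k % 2 = 1 then -1 else 1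
  cup_cap _ := rfl
  phi_symm x y := by simp [eq_comm]
  shift_zero _ := rfl
  shift_add _ _ _ := rfl
  below_shift _ _ := rfl
  above_shift _ _ := rfl
  chi_shift _ _ := rfl
  shift_below _ := rfl
  shift_above _ := rfl
  weight_shift_left _ _ _ _ _ := rfl
  weight_shift_right _ _ _ _ _ := rfl
  weight_chi_left k s n x y := by by_cases h : x = 2 <;> simp [h]
  weight_chi_right k s n x y := by by_cases h : y = 2 <;> simp [h]
  weight_mul k x y := by split_ifs <;> rfl

/-- Only the third moves carry a crossing of colours `0` and `1` across a strand of colour `2`. -/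
theorem triple_sound (N : Move) (h₃ : N ≠ .Γ3) (h₃a : N ≠ .Γ3a) :
    triple.reading.Sound N.rule := by
  cases N
  · exact sound_Γ1 _ fun _ _ => by simp [triple]
  · exact sound_Γ1' _ fun _ _ => by simp [triple]
  · exact sound_Γ1a _ fun _ _ => by simp [triple]
  · exact sound_Γ2 _
  · exact sound_Γ2b _
  · exact sound_Γ2c _
  · exact absurd rfl h₃
  · exact absurd rfl h₃a
  · exact sound_Γ4 _ fun _ _ _ => rfl
  · exact sound_Γ4' _ fun _ _ _ => rfl
  · exact sound_Γ5 _ fun _ _ => by simp [triple, eq_comm]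
  · exact sound_Γ6 _ fun _ => by simp [triple]
  · exact sound_Γ6' _ fun _ => by simp [triple]
  · exact sound_Γ7 _ (by decide)
  · exact sound_Γ8 _ fun _ _ _ => ⟨rfl, rfl⟩

/-- The colours, divided into three classes of `4`, `1` and `1` elements, of which the first two
together form a cycle. -/
def slideClass : Option (ZMod 5) → Fin 3
  | none => 2
  | some x => if x = 4 then 1 else 0

/-- Colourings of the strands by the elements of a cycle and one further colour `none`. A strand
that passes below, respectively above, a strand of colour `none` is shifted by `m`, respectively
`n` steps on the cycle. At a marked vertex, the two colours lie in the same class. -/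
def slide (m n : ℤ) : StateSum (Option (ZMod 5)) (ZMod 3) where
  cupW _ := 1
  capW _ := 1
  phi x y := if slideClass x = slideClass y then 1 else 0
  shift k x := x.map (· + k)
  below x := if x = none then m else 0
  above x := if x = none then n else 0
  chi _ := 0
  weight _ _ _ _ := 1
  cup_cap _ := rfl
  phi_symm x y := by simp [eq_comm]
  shift_zero x := by simp
  shift_add i j x := by cases x <;> simp; ring
  below_shift _ _ := by simp
  above_shift _ _ := by simp
  chi_shift _ _ := rfl
  shift_below x := by cases x <;> simp
  shift_above x := by cases x <;> simp
  weight_shift_left _ _ _ _ _ := rfl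
  weight_shift_right _ _ _ _ _ := rfl
  weight_chi_left _ _ _ _ _ := rfl
  weight_chi_right _ _ _ _ _ := rfl
  weight_mul _ _ _ := rfl

theorem slideClass_none_iff (x : Option (ZMod 5)) : slideClass x = 2 ↔ x = none := by
  revert x; decide

/-- The class sizes 4, 1, 1 are all 1 modulo 3, which gives Γ6; `none` forms a class of its own,
which gives Γ8. A rotation of the cycle does not preserve the classes, so Γ4 and Γ4' are available
only when the corresponding shift is zero. -/
theorem slide_sound (m n : ℤ) (N : Move) (h₄ : N = .Γ4 → m = 0) (h₄' : N = .Γ4' → n = 0) :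
    (slide m n).reading.Sound N.rule := by
  cases N
  · exact sound_Γ1 _ fun _ _ => rfl
  · exact sound_Γ1' _ fun _ _ => rfl
  · exact sound_Γ1a _ fun _ _ => rfl
  · exact sound_Γ2 _
  · exact sound_Γ2b _
  · exact sound_Γ2c _
  · exact sound_Γ3 _ fun _ _ _ _ => rfl
  · exact sound_Γ3a _ fun _ _ _ _ => rfl
  · exact sound_Γ4 _ fun _ _ _ => by simp [slide, h₄ rfl]
  · exact sound_Γ4' _ fun _ _ _ => by simp [slide, h₄' rfl]
  · refine sound_Γ5 _ fun a b => ?_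
    have h (x : ZMod 5) : slideClass (some x) ≠ 2 := by simp [slideClass_none_iff]
    cases a <;> cases b
    · rfl
    · simp [slide, (h _).symm, slideClass_none_iff, slideClass.eq_1]
    · simp [slide, (h _).symm, slideClass_none_iff, slideClass.eq_1]
    · simp [slide, eq_comm]
  · exact sound_Γ6 _ (by simp only [slide]; decide)
  · exact sound_Γ6' _ fun _ => by simp [slide]
  · exact sound_Γ7 _ (by simp only [slide]; decide)
  · refine sound_Γ8 _ fun x y h => ?_
    have h : slideClass x = slideClass y := by simpa [slide] using h
    have h' : x = none ↔ y = none := by rw [← slideClass_none_iff, ← slideClass_none_iff, h]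
    simp [slide, h']

/-- Two colours, with a weight at marked vertices that is not idempotent. -/
def swap : StateSum Bool ℤ where
  cupW | .up => -1 | .down => 1
  capW | .up => 1 | .down => -1
  phi x y := if x = y then 1 else -2
  shift _ x := x
  below _ := 0
  above _ := 0
  chi _ := 0
  weight _ _ _ _ := -1
  cup_cap d := by cases d <;> rfl
  phi_symm x y := by simp [eq_comm]
  shift_zero _ := rfl
  shift_add _ _ _ := rfl
  below_shift _ _ := rfl
  above_shift _ _ := rfl
  chi_shift _ _ := rfl
  shift_below _ := rfl
  shift_above _ := rfl
  weight_shift_left _ _ _ _ _ := rfl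
  weight_shift_right _ _ _ _ _ := rfl
  weight_chi_left _ _ _ _ _ := rfl
  weight_chi_right _ _ _ _ _ := rfl
  weight_mul _ _ _ := rfl

/-- The row sum `1 - 2 = -1` of `phi` cancels the factor `-1` of a circle in Γ6, and the crossing
weight `-1` does so in kinks. Γ7 would need `1 * (-2) = (-2) * (-2)`. -/
theorem swap_sound (N : Move) (h₇ : N ≠ .Γ7) : swap.reading.Sound N.rule := by
  cases N
  · exact sound_Γ1 _ fun _ _ => rfl
  · exact sound_Γ1' _ fun _ _ => rfl
  · exact sound_Γ1a _ fun _ _ => rfl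
  · exact sound_Γ2 _
  · exact sound_Γ2b _
  · exact sound_Γ2c _
  · exact sound_Γ3 _ fun _ _ _ _ => rfl
  · exact sound_Γ3a _ fun _ _ _ _ => rfl
  · exact sound_Γ4 _ fun _ _ _ => rfl
  · exact sound_Γ4' _ fun _ _ _ => rfl
  · exact sound_Γ5 _ fun _ _ => by simp [swap, eq_comm]
  · exact sound_Γ6 _ (by decide)
  · exact sound_Γ6' _ fun _ => by simp [swap]
  · exact absurd rfl h₇
  · exact sound_Γ8 _ fun _ _ _ => ⟨rfl, rfl⟩

end StateSum

/-! ### Moves detected by state sums. -/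

namespace Move

open StateSum Dir Over Marker Piece

theorem Γ1_independentFrom {T : Set Move} (h : Γ1 ∉ T) : Γ1.IndependentFrom T :=
  (kink 2 3 rfl).independentFrom
    (fun N hN => kink_sound _ _ _ N (fun e => absurd (e ▸ hN) h) (fun _ => rfl) (fun _ => rfl))
    [⟨[], cup up, []⟩] [⟨[], cap up, []⟩] [] [down] (by decide) (by decide) (by decide +kernel)

theorem Γ1'_independentFrom {T : Set Move} (h : Γ1' ∉ T) (h' : Γ1a ∉ T) : Γ1'.IndependentFrom T :=
  (kink 3 2 rfl).independentFrom
    (fun N hN => kink_sound _ _ _ N (fun _ => rfl) (fun e => absurd (e ▸ hN) h)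
      (fun e => absurd (e ▸ hN) h'))
    [⟨[], cup down, []⟩] [⟨[], cap down, []⟩] [] [up] (by decide) (by decide) (by decide +kernel)

theorem Γ1a_independentFrom {T : Set Move} (h : Γ1' ∉ T) (h' : Γ1a ∉ T) : Γ1a.IndependentFrom T :=
  (kink 3 2 rfl).independentFrom
    (fun N hN => kink_sound _ _ _ N (fun _ => rfl) (fun e => absurd (e ▸ hN) h)
      (fun e => absurd (e ▸ hN) h'))
    [⟨[], cup up, []⟩] [⟨[], cap up, []⟩] [] [down] (by decide) (by decide) (by decide +kernel)

theorem Γ3_independentFrom {T : Set Move} (h : Γ3 ∉ T) (h' : Γ3a ∉ T) : Γ3.IndependentFrom T :=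
  triple.independentFrom
    (fun N hN => triple_sound N (fun e => h (e ▸ hN)) (fun e => h' (e ▸ hN)))
    -- Three closed curves, each two of which cross twice. The move flips the sign of every
    -- colouring that uses all three colours; all other colourings contribute 1.
    [⟨[], cup up, []⟩, ⟨[up], cup up, [down]⟩, ⟨[up, up, down], cup up, [down]⟩,
      ⟨[up, up, down, up], cross falling down down, []⟩]
    [⟨[], cross falling up up, [down, up, down, down]⟩, ⟨[up], cap up, [up, down, down]⟩,
      ⟨[up, up], cross rising down down, []⟩, ⟨[up], cap up, [down]⟩, ⟨[], cap up, []⟩]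
    [up, up] [down] (by decide) (by decide) (by decide +kernel)

theorem Γ3a_independentFrom {T : Set Move} (h : Γ3 ∉ T) (h' : Γ3a ∉ T) : Γ3a.IndependentFrom T :=
  triple.independentFrom
    (fun N hN => triple_sound N (fun e => h (e ▸ hN)) (fun e => h' (e ▸ hN)))
    [⟨[], cup down, []⟩, ⟨[down], cup down, [up]⟩, ⟨[down, down], cup down, [up, up]⟩,
      ⟨[down, down, down], cross falling up up, [up]⟩]
    [⟨[down, down], cross falling down up, [up, up]⟩, ⟨[down, down, up], cap down, [up]⟩,
      ⟨[], cross falling down down, [up, up]⟩, ⟨[down], cap down, [up]⟩, ⟨[], cap down, []⟩]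
    [down, down, down] [] (by decide) (by decide) (by decide +kernel)

theorem Γ4_independentFrom {T : Set Move} (h : Γ4 ∉ T) : Γ4.IndependentFrom T :=
  (slide 1 0).independentFrom
    (fun N hN => slide_sound _ _ N (fun e => absurd (e ▸ hN) h) (fun _ => rfl))
    [⟨[], cup up, []⟩, ⟨[up], cup down, [down]⟩, ⟨[up, down], cup down, [up, down]⟩,
      ⟨[up, down, down], cross falling up up, [down]⟩,
      ⟨[up, down, down, up], cross falling up down, []⟩,
      ⟨[up, down, down], cup down, [up, down, up]⟩]
    [⟨[up, down, down], cross rising down up, [down, up, up]⟩,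
      ⟨[up, down, down, up], cross rising down down, [up, up]⟩,
      ⟨[up, down, down, up, down, down], cross rising up up, []⟩,
      ⟨[up, down, down, up, down], cap down, [up]⟩, ⟨[up, down], cross rising down up, [down, up]⟩,
      ⟨[up, down, up], cross rising down down, [up]⟩, ⟨[up, down, up, down], cap down, []⟩,
      ⟨[up], vertex vertical down, [down]⟩, ⟨[], cap up, [up, down]⟩, ⟨[], cap up, []⟩]
    [up, down, down, down] [up] (by decide) (by decide) (by decide +kernel)

theorem Γ4'_independentFrom {T : Set Move} (h : Γ4' ∉ T) : Γ4'.IndependentFrom T :=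
  (slide 0 1).independentFrom
    (fun N hN => slide_sound _ _ N (fun _ => rfl) (fun e => absurd (e ▸ hN) h))
    -- The diagrams used for Γ4 with every crossing changed, which exchanges the roles of `m` and
    -- `n`.
    [⟨[], cup up, []⟩, ⟨[up], cup down, [down]⟩, ⟨[up, down], cup down, [up, down]⟩,
      ⟨[up, down, down], cross rising up up, [down]⟩,
      ⟨[up, down, down, up], cross rising up down, []⟩,
      ⟨[up, down, down], cup down, [up, down, up]⟩]
    [⟨[up, down, down], cross falling down up, [down, up, up]⟩,
      ⟨[up, down, down, up], cross falling down down, [up, up]⟩,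
      ⟨[up, down, down, up, down, down], cross falling up up, []⟩,
      ⟨[up, down, down, up, down], cap down, [up]⟩, ⟨[up, down], cross falling down up, [down, up]⟩,
      ⟨[up, down, up], cross falling down down, [up]⟩, ⟨[up, down, up, down], cap down, []⟩,
      ⟨[up], vertex vertical down, [down]⟩, ⟨[], cap up, [up, down]⟩, ⟨[], cap up, []⟩]
    [up, down, down, down] [up] (by decide) (by decide) (by decide +kernel)

theorem Γ7_independentFrom {T : Set Move} (h : Γ7 ∉ T) : Γ7.IndependentFrom T :=
  swap.independentFrom (fun N hN => swap_sound N fun e => h (e ▸ hN))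
    [⟨[], cup down, []⟩, ⟨[down, up], cup down, []⟩] [⟨[down], cap up, [up]⟩, ⟨[], cap down, []⟩]
    [down] [] (by decide) (by decide) (by decide +kernel)

end Move

/-! ### Parities given by products of signs. -/

/-- The product of the weights of the pieces of a diagram. -/
def weightProd (w : Piece → ℤ) (T : List Layer) : ℤ := (T.map fun L => w L.piece).prod

theorem weightProd_applies {w : Piece → ℤ} {ρ : Rule} (h : weightProd w ρ.1 = weightProd w ρ.2)
    {D D' : Diagram} (hD : Applies ρ D D') : weightProd w D.layers = weightProd w D'.layers := by
  obtain ⟨below, above, l, r, h₁, h₂⟩ := hD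
  have key : ∀ T : List Layer, weightProd w (T.map (Layer.pad l r)) = weightProd w T := fun T => by
    simp [weightProd, Layer.pad, Function.comp_def]
  have mul : ∀ S T : List Layer, weightProd w (S ++ T) = weightProd w S * weightProd w T :=
    fun S T => by simp [weightProd]
  rw [h₁, h₂, mul, mul, mul, mul, key, key, h]

/-- The weight of a piece counts its contribution to the rotation number of a smoothing modulo two,
together with the crossings and the marked vertices. -/
structure IsRotationWeight (w : Piece → ℤ) : Prop where
  zigzag : ∀ d, w (.cup d) * w (.cap d.op) = 1
  cross : ∀ o d e, w (.cross o d e) = w (.cross o.turn e d.op)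
  vertex_cap : ∀ m d, w (.vertex m d) * w (.cap d.op) = w (.vertex m.turn d.op) * w (.cap d)
  vertex_cup : ∀ m d, w (.cup d) * w (.vertex m d.op) = w (.cup d.op) * w (.vertex m.turn d)

theorem Move.independentFrom_of_weight {w : Piece → ℤ} (hw : IsRotationWeight w) {M : Move}
    {T : Set Move} (h : ∀ N ∈ T, weightProd w N.rule.1 = weightProd w N.rule.2)
    (below above : List Layer) (l r : List Dir)
    (h₁ : Fits [] (below ++ M.rule.1.map (Layer.pad l r) ++ above) [])
    (h₂ : Fits [] (below ++ M.rule.2.map (Layer.pad l r) ++ above) [])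
    (hne : weightProd w (below ++ M.rule.1.map (Layer.pad l r) ++ above) ≠
      weightProd w (below ++ M.rule.2.map (Layer.pad l r) ++ above)) : M.IndependentFrom T := by
  refine Move.independentFrom_of_invariant (fun D => weightProd w D.layers)
    (fun ρ hρ _ _ hD => weightProd_applies ?_ hD)
    (fun N hN _ _ hD => weightProd_applies (h N hN) hD) below above l r h₁ h₂ hne
  cases hρ with
  | exchange p q m => simp [weightProd, mul_comm]
  | zigzag_right d => simpa [weightProd] using hw.zigzag d.op
  | zigzag_left d => simpa [weightProd] using hw.zigzag d
  | cross_cap o d e =>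
    have h := hw.cross o.turn d e
    rw [show o.turn.turn = o by cases o <;> rfl] at h
    simp [weightProd, h]
  | cross_cup o d e =>
    have h := hw.cross o.turn e d
    rw [show o.turn.turn = o by cases o <;> rfl] at h
    simp [weightProd, h, hw.cross o d.op e]
  | vertex_cap m d => simpa [weightProd] using hw.vertex_cap m d
  | vertex_cup m d => simpa [weightProd] using hw.vertex_cup m d

/-- The parity of the number of negative crossings. -/
def negativeWeight : Piece → ℤ
  | .cross .rising d e => if d = e then 1 else -1
  | .cross .falling d e => if d = e then -1 else 1
  | _ => 1

/-- The parity of the rotation number of the smoothing at the vertices with marker `m.turn`, plus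
the number of crossings and vertices. -/
def smoothingWeight (m : Marker) : Piece → ℤ
  | .cup .up => -1
  | .cup .down => 1
  | .cap .up => 1
  | .cap .down => -1
  | .cross _ _ _ => -1
  | .vertex m' _ => if m = m' then 1 else -1

theorem isRotationWeight_negativeWeight : IsRotationWeight negativeWeight where
  zigzag d := rfl
  cross o d e := by cases o <;> cases d <;> cases e <;> rfl
  vertex_cap m d := rfl
  vertex_cup m d := rfl

theorem isRotationWeight_smoothingWeight (m : Marker) : IsRotationWeight (smoothingWeight m) where
  zigzag d := by cases d <;> rfl
  cross o d e := rfl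
  vertex_cap m' d := by cases m <;> cases m' <;> cases d <;> rfl
  vertex_cup m' d := by cases m <;> cases m' <;> cases d <;> rfl

namespace Move

open Dir Over Marker Piece

/-- Γ2 removes exactly one negative crossing. Γ8 is harmless, as two of its four crossings are
negative on either side. -/
theorem Γ2_independentFrom {T : Set Move} (h : Γ2 ∉ T) (h₁ : Γ1a ∉ T) (h₂ : Γ2b ∉ T)
    (h₃ : Γ2c ∉ T) : Γ2.IndependentFrom T :=
  independentFrom_of_weight isRotationWeight_negativeWeight
    (fun N hN => by cases N <;> first | contradiction | decide)
    [⟨[], cup up, []⟩, ⟨[up], cup up, [down]⟩] [⟨[up], cap up, [down]⟩, ⟨[], cap up, []⟩]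
    [] [down, down] (by decide) (by decide) (by decide)

/-- By Whitney's formula, rotation number plus number of crossings has the parity of the number of
components of the smoothed diagram. Γ6 splits off a component in this smoothing and Γ6' does not;
for the opposite smoothing the roles are exchanged. -/
theorem Γ6_independentFrom {T : Set Move} (h : Γ6 ∉ T) : Γ6.IndependentFrom T :=
  independentFrom_of_weight (isRotationWeight_smoothingWeight vertical)
    (fun N hN => by cases N <;> first | contradiction | decide)
    [⟨[], cup up, []⟩] [⟨[], cap up, []⟩] [] [down] (by decide) (by decide) (by decide)

theorem Γ6'_independentFrom {T : Set Move} (h : Γ6' ∉ T) : Γ6'.IndependentFrom T :=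
  independentFrom_of_weight (isRotationWeight_smoothingWeight horizontal)
    (fun N hN => by cases N <;> first | contradiction | decide)
    [⟨[], cup up, []⟩] [⟨[], cap up, []⟩] [] [down] (by decide) (by decide) (by decide)

end Move

/-! ### Alexander indices of regions, for Γ2b. -/

/-- The Alexander indices of the regions on the left, between and on the right of the strands `u`
are not positive, if the region on the left has index `k`. The index drops by one from the left to
the right of a strand that points up. -/
def IndexNonpos : ℤ → List Dir → Prop
  | k, [] => k ≤ 0
  | k, d :: u => k ≤ 0 ∧ IndexNonpos (k - d.sign) u

/-- The change of the Alexander index across the strands `u`. -/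
def indexDrop (u : List Dir) : ℤ := (u.map Dir.sign).sum

theorem indexNonpos_append (k : ℤ) (u v : List Dir) :
    IndexNonpos k (u ++ v) ↔ IndexNonpos k u ∧ IndexNonpos (k - indexDrop u) v := by
  induction u generalizing k with
  | nil => cases v <;> simp [IndexNonpos, indexDrop]
  | cons d u ih => simp [IndexNonpos, ih, indexDrop, and_assoc, sub_sub]

/-- The regions of a tangle have indices that are not positive. -/
def IndicesNonpos (k : ℤ) (T : List Layer) : Prop :=
  ∀ L ∈ T, IndexNonpos k L.bot ∧ IndexNonpos k L.top

theorem Piece.indexDrop_top (p : Piece) : indexDrop p.top = indexDrop p.bot := by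
  cases p <;> simp [indexDrop, Piece.top, Piece.bot, add_comm]

theorem Layer.indexDrop_top (L : Layer) : indexDrop L.top = indexDrop L.bot := by
  have := L.piece.indexDrop_top
  simp_all [indexDrop, Layer.top, Layer.bot]

theorem indexNonpos_of_fits {u v : List Dir} {S : List Layer} (hS : Fits u S v) {k : ℤ}
    (hu : IndexNonpos k u) (h : IndicesNonpos k S) : IndexNonpos k v := by
  induction S generalizing u with
  | nil => exact (show u = v from hS) ▸ hu
  | cons L S ih => exact ih hS.2 (h L (by simp)).2 fun L' hL' => h L' (by simp [hL'])

theorem Fits.indexDrop {u v : List Dir} {S : List Layer} (hS : Fits u S v) :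
    ∀ L ∈ S, indexDrop L.bot = indexDrop u := by
  induction S generalizing u with
  | nil => simp
  | cons L S ih =>
    intro L' hL'
    rcases List.mem_cons.1 hL' with rfl | hL'
    · rw [hS.1]
    · rw [ih hS.2 L' hL', L.indexDrop_top, hS.1]

/-- Both sides of a rule fit to the same lower ends, and if the regions at the lower ends have
indices that are not positive, then the same is true for both sides or for none. -/
def IndexSound (ρ : Rule) : Prop :=
  ∃ L T, ρ.1 = L :: T ∧ (∃ v, Fits L.bot ρ.1 v) ∧ (∃ v, Fits L.bot ρ.2 v) ∧
    ∀ k, IndexNonpos k L.bot → (IndicesNonpos k ρ.1 ↔ IndicesNonpos k ρ.2)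

/-- The total drop across a tangle is the same at every height, so the regions beside it keep the
indices they have at its lower ends. -/
theorem indicesNonpos_pad {u v l r : List Dir} {S : List Layer} (hS : Fits u S v)
    (h : IndexNonpos 0 (l ++ u ++ r)) :
    IndicesNonpos 0 (S.map (Layer.pad l r)) ↔ IndicesNonpos (0 - indexDrop l) S := by
  simp only [indexNonpos_append] at h
  obtain ⟨⟨h₁, h₂⟩, h₃⟩ := h
  simp only [IndicesNonpos, List.forall_mem_map]
  refine forall₂_congr fun L hL => ?_
  have hb := hS.indexDrop L hL
  have e₁ : (L.pad l r).bot = l ++ L.bot ++ r := by simp [Layer.bot, Layer.pad]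
  have e₂ : (L.pad l r).top = l ++ L.top ++ r := by simp [Layer.top, Layer.pad]
  have e₃ : ∀ w, indexDrop w = indexDrop u → indexDrop (l ++ w) = indexDrop (l ++ u) := by
    intro w hw; simp_all [indexDrop]
  rw [e₁, e₂]
  simp only [indexNonpos_append, e₃ _ hb, e₃ _ (L.indexDrop_top.trans hb), h₁, h₃, true_and,
    and_true]

theorem IndexSound.applies {ρ : Rule} (h : IndexSound ρ) {D D' : Diagram} (hD : Applies ρ D D') :
    IndicesNonpos 0 D.layers ↔ IndicesNonpos 0 D'.layers := by
  obtain ⟨L, T, hL, ⟨v₁, hf₁⟩, ⟨v₂, hf₂⟩, h⟩ := h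
  obtain ⟨below, above, l, r, h₁, h₂⟩ := hD
  have hf := D.fits
  rw [h₁, List.append_assoc] at hf
  obtain ⟨w, hw₁, hw₂⟩ := hf.append
  have hw : w = l ++ L.bot ++ r := by
    rw [hL] at hw₂
    rw [← hw₂.1]; simp [Layer.bot, Layer.pad]
  have happ : ∀ S T, IndicesNonpos 0 (S ++ T) ↔ IndicesNonpos 0 S ∧ IndicesNonpos 0 T :=
    fun S T => List.forall_mem_append
  rw [h₁, h₂, happ, happ, happ, happ]
  -- If a region of `below` has positive index, both diagrams fail; hence the lower ends may be
  -- assumed nonpositive.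
  refine and_congr_left' (and_congr_right fun hb => ?_)
  have hn : IndexNonpos 0 (l ++ L.bot ++ r) := hw ▸ indexNonpos_of_fits hw₁ le_rfl hb
  rw [indicesNonpos_pad hf₁ hn, indicesNonpos_pad hf₂ hn]
  simp only [indexNonpos_append] at hn
  exact h _ hn.1.2

theorem IndexSound.of_isotopyRule {ρ : Rule} (hρ : IsotopyRule ρ) : IndexSound ρ := by
  cases hρ with
  | exchange p q m =>
    refine ⟨_, _, rfl, ⟨p.top ++ m ++ q.top, ?_⟩, ⟨p.top ++ m ++ q.top, ?_⟩, fun k _ => ?_⟩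
    · simp [Fits, Layer.bot, Layer.top]
    · simp [Fits, Layer.bot, Layer.top]
    · simp [IndicesNonpos, Layer.bot, Layer.top]
      simp only [indexNonpos_append, p.indexDrop_top]
      tauto
  | zigzag_right d =>
    refine ⟨_, _, rfl, ⟨[d], ?_⟩, ⟨[d], rfl⟩, fun k h => ?_⟩
    all_goals cases d <;> simp_all [Fits, Layer.bot, Layer.top, Piece.bot, Piece.top, IndicesNonpos,
      IndexNonpos, Dir.sign, Dir.op]
  | zigzag_left d =>
    refine ⟨_, _, rfl, ⟨[d], ?_⟩, ⟨[d], rfl⟩, fun k h => ?_⟩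
    all_goals cases d <;> simp_all [Fits, Layer.bot, Layer.top, Piece.bot, Piece.top, IndicesNonpos,
      IndexNonpos, Dir.sign, Dir.op]
  | cross_cap o d e =>
    refine ⟨_, _, rfl, ⟨_, rfl, rfl, rfl⟩, ⟨_, rfl, rfl, rfl⟩, fun k h => ?_⟩
    cases d <;> cases e <;> simp_all [Layer.bot, Layer.top, Piece.bot, Piece.top, IndicesNonpos,
      IndexNonpos, Dir.sign, Dir.op]
  | cross_cup o d e =>
    refine ⟨_, _, rfl, ⟨_, rfl, rfl, rfl⟩, ⟨_, rfl, rfl, rfl⟩, fun k h => ?_⟩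
    cases d <;> cases e <;> simp_all [Layer.bot, Layer.top, Piece.bot, Piece.top, IndicesNonpos,
      IndexNonpos, Dir.sign, Dir.op]
  | vertex_cap m d =>
    refine ⟨_, _, rfl, ⟨[d.op], ?_⟩, ⟨[d.op], ?_⟩, fun k h => ?_⟩
    all_goals cases d <;> simp_all [Fits, Layer.bot, Layer.top, Piece.bot, Piece.top, IndicesNonpos,
      IndexNonpos, Dir.sign, Dir.op]
  | vertex_cup m d =>
    refine ⟨_, _, rfl, ⟨[d, d.op, d], ?_⟩, ⟨[d, d.op, d], ?_⟩, fun k h => ?_⟩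
    all_goals cases d <;> simp_all [Fits, Layer.bot, Layer.top, Piece.bot, Piece.top, IndicesNonpos,
      IndexNonpos, Dir.sign, Dir.op]

namespace Move

open Dir Over Marker Piece

/-- In these moves no index exceeds the largest one at the lower ends. The three excluded moves have
a side on which a region exceeds it by one. -/
theorem indexSound (N : Move) (h₁ : N ≠ Γ1') (h₂ : N ≠ Γ2b) (h₃ : N ≠ Γ3) : IndexSound N.rule := by
  have hf : ∃ u v, Fits u N.rule.1 v ∧ Fits u N.rule.2 v := by
    cases N
    exacts [⟨[up], [up], by decide⟩, ⟨[down], [down], by decide⟩, ⟨[up], [up], by decide⟩,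
      ⟨[up, up], [up, up], by decide⟩, ⟨[up, down], [up, down], by decide⟩,
      ⟨[down, up], [down, up], by decide⟩, ⟨[down, up, down], [down, up, down], by decide⟩,
      ⟨[up, up, up], [up, up, up], by decide⟩, ⟨[up, up, down], [up, down, up], by decide⟩,
      ⟨[up, up, down], [up, down, up], by decide⟩, ⟨[down, down], [down, down], by decide⟩,
      ⟨[up], [up], by decide⟩, ⟨[up], [up], by decide⟩, ⟨[up, down, up], [up, down, up], by decide⟩,
      ⟨[up, down, up, down], [up, down, up, down], by decide⟩]
  obtain ⟨u, v, hf₁, hf₂⟩ := hf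
  cases N <;> first
    | contradiction
    | refine ⟨_, _, rfl, ⟨v, hf₁.1 ▸ hf₁⟩, ⟨v, hf₁.1 ▸ hf₂⟩, fun k h => ?_⟩
      clear hf₁ hf₂
      simp_all [Layer.bot, Layer.top, Piece.bot, Piece.top, IndicesNonpos, IndexNonpos, Dir.sign,
        Dir.op, rule]
      try omega

theorem Γ2b_independentFrom {T : Set Move} (h : Γ2b ∉ T) (h₁ : Γ1' ∉ T) (h₃ : Γ3 ∉ T) :
    Γ2b.IndependentFrom T := by
  refine independentFrom_of_invariant (fun D => IndicesNonpos 0 D.layers)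
    (fun ρ hρ _ _ hD => propext ((IndexSound.of_isotopyRule hρ).applies hD))
    (fun N hN _ _ hD => propext ((N.indexSound (fun e => h₁ (e ▸ hN)) (fun e => h (e ▸ hN))
      (fun e => h₃ (e ▸ hN))).applies hD))
    [⟨[], cup up, []⟩] [⟨[], cap up, []⟩] [] [] (by decide) (by decide) ?_
  simp [IndicesNonpos, IndexNonpos, Layer.bot, Layer.top, Layer.pad, Piece.bot, Piece.top, rule,
    Dir.sign, Dir.op]

end Move

/-! ### Colourings with non-surjective translations, for Γ2c. -/

/-- A self-distributive operation on `ℤ × ℤ`, given by `a + t (x - a)` for an injective but not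
surjective linear map `t`. -/
def star (a x : ℤ × ℤ) : ℤ × ℤ := (a.1 + 4 * (x.2 - a.2), a.2 + (x.1 - a.1))

theorem star_inj {a x y : ℤ × ℤ} : star a x = star a y ↔ x = y := by
  simp only [star, Prod.ext_iff]; omega

theorem star_self (a : ℤ × ℤ) : star a a = a := by simp [star]

theorem star_eq_self {a x : ℤ × ℤ} : star a x = a ↔ x = a := by
  simp only [star, Prod.ext_iff]; omega

theorem star_star (a b c : ℤ × ℤ) : star (star a b) (star a c) = star a (star b c) := by
  simp only [star, Prod.ext_iff]; constructor <;> ring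

/-- The parity of the first coordinate. -/
def par (x : ℤ × ℤ) : ℤ := x.1 % 2

/-- The first coordinate of `t (x - a)` is a multiple of 4. Hence an arc of colour `star a x` adds
no parity beyond that of the over-strand `a`. -/
theorem par_star (a x : ℤ × ℤ) : par (star a x) = par a := by
  simp only [par, star]; omega

/-- With `c = star a n`, this says that solvability of `c = star a n` is symmetric in `a` and `c`,
as `c - a` lies in the image of `t` exactly when `a - c` does; the new solution has the parity of
the old one. It is used for Γ8. -/
theorem exists_star_eq (a n : ℤ × ℤ) :
    a = star (star a n) (a + star a n - n) ∧ par (a + star a n - n) = par n := by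
  simp only [star, par, Prod.ext_iff, Prod.fst_add, Prod.snd_add, Prod.fst_sub, Prod.snd_sub]
  omega

/-- The relation between the colours of a strand on the right and on the left of a strand of
colour `a` that it passes below; the latter strand has direction `d`. -/
def pass : Dir → ℤ × ℤ → ℤ × ℤ → ℤ × ℤ → Prop
  | .up, a, x, y => y = star a x
  | .down, a, x, y => x = star a y

theorem pass_op (d : Dir) (a x y : ℤ × ℤ) : pass d.op a x y ↔ pass d a y x := by cases d <;> rfl

/-- Colourings of the strands of a diagram by `ℤ × ℤ`, whose parities are recorded in a set. -/
def parityAct : Piece → (List (ℤ × ℤ) → Set ℤ → Prop) → List (ℤ × ℤ) → Set ℤ → Prop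
  | .cup _, f, u, S => ∃ c, f (c :: c :: u) (insert (par c) S)
  | .cap _, f, a :: b :: u, S => a = b ∧ f u S
  | .cross .rising d _, f, a :: b :: u, S =>
    ∃ n, pass d a b n ∧ f (n :: a :: u) (insert (par n) S)
  | .cross .falling _ e, f, a :: b :: u, S =>
    ∃ n, pass e b n a ∧ f (b :: n :: u) (insert (par n) S)
  | .vertex _ _, f, a :: b :: u, S => a = b ∧ f (a :: b :: u) S
  | _, _, _, _ => False

/-- The reading of diagrams by the colourings by `ℤ × ℤ`. -/
def parityReading : Reading (ℤ × ℤ) (Set ℤ → Prop) (Set ℤ) where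
  push k _ x := insert (par x) k
  act p _ := parityAct p
  -- Recording a parity twice changes nothing, so two sides need to agree only once the parities of
  -- all strands at this height have been recorded.
  rel k u A B := ∀ S, k ⊆ S → (∀ x ∈ u, par x ∈ S) → (A S ↔ B S)
  rel_cons k d x u A B := by
    simp only [Set.insert_subset_iff, List.forall_mem_cons, and_imp]
    exact forall_congr' fun S => ⟨fun h h₁ h₂ => h h₂ h₁, fun h h₁ h₂ => h h₂ h₁⟩
  act_congr p k n f g h u hu S hk hS := by
    have ins : ∀ (c : ℤ × ℤ) (v : List (ℤ × ℤ)), (∀ x ∈ v, par x ∈ S) →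
        ∀ x ∈ v, par x ∈ insert (par c) S := fun c v hv x hx => Set.mem_insert_of_mem _ (hv x hx)
    have hk' : ∀ c : ℤ × ℤ, k ⊆ insert (par c) S := fun c => hk.trans (Set.subset_insert _ _)
    match p, u with
    | .cup d, u =>
      refine exists_congr fun c => h _ (by simp_all [Piece.top, Piece.bot]; omega) _ (hk' c) ?_
      simpa using fun a b hx => Or.inr (hS (a, b) hx)
    | .cap d, a :: b :: u =>
      refine and_congr_right fun _ => h _ (by simp_all [Piece.top, Piece.bot]; omega) _ hk ?_
      simp_all
    | .cross .rising d e, a :: b :: u =>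
      refine exists_congr fun c => and_congr_right fun _ =>
        h _ (by simp_all [Piece.top, Piece.bot]) _ (hk' c) ?_
      simp_all
    | .cross .falling d e, a :: b :: u =>
      refine exists_congr fun c => and_congr_right fun _ =>
        h _ (by simp_all [Piece.top, Piece.bot]) _ (hk' c) ?_
      simp_all
    | .vertex m d, a :: b :: u =>
      exact and_congr_right fun _ => h _ (by simp_all [Piece.top, Piece.bot]) _ hk hS
    | .cap _, [] | .cap _, [_] | .cross .rising _ _, [] | .cross .rising _ _, [_]
    | .cross .falling _ _, [] | .cross .falling _ _, [_]
    | .vertex _ _, [] | .vertex _ _, [_] => exact Iff.rfl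

namespace parityReading

@[simp] theorem reading_push (k : Set ℤ) (d : Dir) (x : ℤ × ℤ) :
    parityReading.push k d x = insert (par x) k := rfl

@[simp] theorem reading_act : parityReading.act = fun p _ => parityAct p := rfl

theorem rel_iff (k : Set ℤ) (u : List (ℤ × ℤ)) (A B : Set ℤ → Prop) :
    parityReading.rel k u A B ↔
      ∀ S, k ⊆ S → (∀ x ∈ u, par x ∈ S) → (A S ↔ B S) := Iff.rfl

theorem act_exists (p : Piece) {ι : Type*} (P : ι → Prop)
    (f : ι → List (ℤ × ℤ) → Set ℤ → Prop) (u : List (ℤ × ℤ)) :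
    parityAct p (fun v S => ∃ i, P i ∧ f i v S) u = fun S => ∃ i, P i ∧ parityAct p (f i) u S := by
  funext S
  rw [eq_iff_iff]
  unfold parityAct
  split
  · exact ⟨fun ⟨c, i, h⟩ => ⟨i, h.1, c, h.2⟩, fun ⟨i, h, c, h'⟩ => ⟨c, i, h, h'⟩⟩
  · exact ⟨fun ⟨h, i, h'⟩ => ⟨i, h'.1, h, h'.2⟩, fun ⟨i, h, h', h''⟩ => ⟨h', i, h, h''⟩⟩
  · exact ⟨fun ⟨n, h, i, h'⟩ => ⟨i, h'.1, n, h, h'.2⟩, fun ⟨i, h, n, h', h''⟩ => ⟨n, h', i, h, h''⟩⟩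
  · exact ⟨fun ⟨n, h, i, h'⟩ => ⟨i, h'.1, n, h, h'.2⟩, fun ⟨i, h, n, h', h''⟩ => ⟨n, h', i, h, h''⟩⟩
  · exact ⟨fun ⟨h, i, h'⟩ => ⟨i, h'.1, h, h'.2⟩, fun ⟨i, h, h', h''⟩ => ⟨h', i, h, h''⟩⟩
  · simp

theorem act_insert (p : Piece) (c : ℤ) (f : List (ℤ × ℤ) → Set ℤ → Prop)
    (u : List (ℤ × ℤ)) :
    parityAct p (fun v S => f v (insert c S)) u = fun S => parityAct p f u (insert c S) := by
  funext S
  unfold parityAct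
  split <;> simp only [Set.insert_comm c]

theorem opL_exists (p : Piece) (l : List Dir) (k : Set ℤ) {ι : Type*} (P : ι → Prop)
    (f : ι → List (ℤ × ℤ) → Set ℤ → Prop) (u : List (ℤ × ℤ)) :
    parityReading.opL p l k (fun v S => ∃ i, P i ∧ f i v S) u =
      fun S => ∃ i, P i ∧ parityReading.opL p l k (f i) u S := by
  induction l generalizing k f u with
  | nil => exact act_exists p P f u
  | cons d l ih =>
    cases u with
    | nil => rfl
    | cons x u => exact ih _ _ _

theorem opL_insert (p : Piece) (l : List Dir) (k : Set ℤ) (c : ℤ)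
    (f : List (ℤ × ℤ) → Set ℤ → Prop) (u : List (ℤ × ℤ)) :
    parityReading.opL p l k (fun v S => f v (insert c S)) u =
      fun S => parityReading.opL p l k f u (insert c S) := by
  induction l generalizing k f u with
  | nil => exact act_insert p c f u
  | cons d l ih =>
    cases u with
    | nil => rfl
    | cons x u => exact ih _ _ _

theorem opL_context (p : Piece) (l : List Dir) (k k' : Set ℤ) (f : List (ℤ × ℤ) → Set ℤ → Prop)
    (u : List (ℤ × ℤ)) : parityReading.opL p l k f u = parityReading.opL p l k' f u := by
  induction l generalizing k k' f u with
  | nil => rfl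
  | cons d l ih =>
    cases u with
    | nil => rfl
    | cons x u => exact ih _ _ _ _

theorem opL_and (p : Piece) (l : List Dir) (k : Set ℤ) (P : Prop)
    (f : List (ℤ × ℤ) → Set ℤ → Prop) (u : List (ℤ × ℤ)) :
    parityReading.opL p l k (fun v S => P ∧ f v S) u =
      fun S => P ∧ parityReading.opL p l k f u S := by
  simpa using opL_exists p l k (fun _ : Unit => P) (fun _ => f) u

theorem act_opL (p q : Piece) (m : List Dir) (k : Set ℤ) (f : List (ℤ × ℤ) → Set ℤ → Prop)
    (u : List (ℤ × ℤ)) (hu : p.bot.length ≤ u.length) :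
    parityAct p (parityReading.opL q (p.top ++ m) k f) u =
      parityReading.opL q (p.bot ++ m) k (parityAct p f) u := by
  have key : ∀ {ι : Type} (P : ι → Prop) (c : ι → ℤ) (g : ι → List (ℤ × ℤ) → Set ℤ → Prop)
      (k₁ : ι → Set ℤ) (k₂ : Set ℤ) (v : List (ℤ × ℤ)),
      (fun S => ∃ n, P n ∧ parityReading.opL q m (k₁ n) (g n) v (insert (c n) S)) =
        parityReading.opL q m k₂ (fun w S => ∃ n, P n ∧ g n w (insert (c n) S)) v := by
    intro ι P c g k₁ k₂ v
    rw [opL_exists q m k₂ P (fun n w S => g n w (insert (c n) S))]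
    funext S
    exact propext (exists_congr fun n => and_congr_right fun _ => by
      rw [opL_insert, opL_context q m (k₁ n) k₂])
  match p, u, hu with
  | .cup d, u, _ =>
    have h := key (fun _ => True) par (fun c v => f (c :: c :: v))
    simp only [true_and] at h
    exact h _ _ u
  | .cap d, a :: b :: u, _ =>
    refine Eq.trans ?_ (opL_and q m _ (a = b) f u).symm
    rw [opL_context q m _ k]
    rfl
  | .cross .rising d e, a :: b :: u, _ =>
    exact key (pass d a b) par (fun n v => f (n :: a :: v)) _ _ u
  | .cross .falling d e, a :: b :: u, _ =>
    exact key (fun n => pass e b n a) par (fun n v => f (b :: n :: v)) _ _ u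
  | .vertex _ d, a :: b :: u, _ =>
    exact (opL_and q m _ (a = b) (fun v => f (a :: b :: v)) u).symm

theorem sound_isotopy {ρ : Rule} (hρ : IsotopyRule ρ) : parityReading.Sound ρ := by
  cases hρ with
  | exchange p q m =>
    refine ⟨_, _, rfl, fun k f u hu => ?_⟩
    simp only [Layer.bot, List.length_append, List.length_nil] at hu
    have h := act_opL p q m k f u (by omega)
    refine (rel_iff _ _ _ _).2 fun S _ _ => iff_of_eq (congrFun ?_ S)
    simpa using h
  | zigzag_right d =>
    refine ⟨_, _, rfl, fun k f u hu => ?_⟩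
    match u, hu with
    | a :: u, _ =>
      refine (rel_iff _ _ _ _).2 fun S _ hS => ?_
      simp_all [parityAct, -Prod.exists, -Prod.forall]
  | zigzag_left d =>
    refine ⟨_, _, rfl, fun k f u hu => ?_⟩
    match u, hu with
    | a :: u, _ =>
      refine (rel_iff _ _ _ _).2 fun S _ hS => ?_
      simp_all [parityAct, -Prod.exists, -Prod.forall]
  | cross_cap o d e =>
    refine ⟨_, _, rfl, fun k f u hu => ?_⟩
    match u, hu with
    | a :: b :: c :: u, _ =>
      refine (rel_iff _ _ _ _).2 fun S _ hS => ?_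
      cases o <;> simp_all [parityAct, pass_op, Over.turn, -Prod.exists, -Prod.forall]
      constructor <;> rintro ⟨n, h, rfl, h'⟩ <;> exact ⟨n, h, rfl, h'⟩
  | cross_cup o d e =>
    refine ⟨_, _, rfl, fun k f u hu => ?_⟩
    match u, hu with
    | a :: u, _ =>
      refine (rel_iff _ _ _ _).2 fun S _ hS => ?_
      cases o <;> simp_all [parityAct, pass_op, Over.turn, -Prod.exists, -Prod.forall]
      constructor <;> rintro ⟨c, n, h, h'⟩ <;> exact ⟨n, c, h, by rwa [Set.insert_comm]⟩
  | vertex_cap m d =>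
    refine ⟨_, _, rfl, fun k f u hu => ?_⟩
    match u, hu with
    | a :: b :: c :: u, _ =>
      refine (rel_iff _ _ _ _).2 fun S _ hS => ?_
      simp_all [parityAct, -Prod.exists, -Prod.forall]
      constructor <;> rintro ⟨rfl, rfl, h⟩ <;> exact ⟨rfl, rfl, h⟩
  | vertex_cup m d =>
    refine ⟨_, _, rfl, fun k f u hu => ?_⟩
    match u, hu with
    | a :: u, _ =>
      refine (rel_iff _ _ _ _).2 fun S _ hS => ?_
      simp_all [parityAct, -Prod.exists, -Prod.forall]

end parityReading

/-! ### Invariance of the parity colourings under the moves. -/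

namespace parityReading

theorem sound_Γ1 : parityReading.Sound Move.Γ1.rule := by
  refine ⟨_, _, rfl, fun k f u hu => ?_⟩
  match u, hu with
  | a :: u, _ =>
    refine (rel_iff _ _ _ _).2 fun S _ hS => ?_
    simp_all [parityAct, pass, Move.rule, star_self, par_star, eq_comm, -Prod.exists,
      -Prod.forall]

theorem sound_Γ1' : parityReading.Sound Move.Γ1'.rule := by
  refine ⟨_, _, rfl, fun k f u hu => ?_⟩
  match u, hu with
  | a :: u, _ =>
    refine (rel_iff _ _ _ _).2 fun S _ hS => ?_
    simp_all [parityAct, pass, Move.rule, eq_comm, -Prod.exists,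
      -Prod.forall]
    have h : ∀ n, a = star a n ↔ n = a := fun n => eq_comm.trans star_eq_self
    simp_all

theorem sound_Γ1a : parityReading.Sound Move.Γ1a.rule := by
  refine ⟨_, _, rfl, fun k f u hu => ?_⟩
  match u, hu with
  | a :: u, _ =>
    refine (rel_iff _ _ _ _).2 fun S _ hS => ?_
    simp_all [parityAct, pass, Move.rule, star_self, eq_comm, -Prod.exists,
      -Prod.forall]

theorem sound_Γ2 : parityReading.Sound Move.Γ2.rule := by
  refine ⟨_, _, rfl, fun k f u hu => ?_⟩
  match u, hu with
  | a :: b :: u, _ =>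
    refine (rel_iff _ _ _ _).2 fun S _ hS => ?_
    simp_all [parityAct, pass, Move.rule, star_inj, par_star, eq_comm, -Prod.exists,
      -Prod.forall]

/-- The intermediate arc is `star a b`, which always exists, and injectivity returns `b`. In Γ2c it
would have to solve `b = star a n`. -/
theorem sound_Γ2b : parityReading.Sound Move.Γ2b.rule := by
  refine ⟨_, _, rfl, fun k f u hu => ?_⟩
  match u, hu with
  | a :: b :: u, _ =>
    refine (rel_iff _ _ _ _).2 fun S _ hS => ?_
    simp_all [parityAct, pass, Move.rule, star_inj, par_star, eq_comm, -Prod.exists,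
      -Prod.forall]

theorem sound_Γ3a : parityReading.Sound Move.Γ3a.rule := by
  refine ⟨_, _, rfl, fun k f u hu => ?_⟩
  match u, hu with
  | a :: b :: c :: u, _ =>
    refine (rel_iff _ _ _ _).2 fun S _ hS => ?_
    simp_all [parityAct, pass, Move.rule, star_star, par_star, eq_comm, -Prod.exists,
      -Prod.forall]

theorem sound_Γ4 : parityReading.Sound Move.Γ4.rule := by
  refine ⟨_, _, rfl, fun k f u hu => ?_⟩
  match u, hu with
  | a :: b :: c :: u, _ =>
    refine (rel_iff _ _ _ _).2 fun S _ hS => ?_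
    simp_all [parityAct, pass, Move.rule, star_inj, par_star, eq_comm, -Prod.exists,
      -Prod.forall]

theorem sound_Γ4' : parityReading.Sound Move.Γ4'.rule := by
  refine ⟨_, _, rfl, fun k f u hu => ?_⟩
  match u, hu with
  | a :: b :: c :: u, _ =>
    refine (rel_iff _ _ _ _).2 fun S _ hS => ?_
    simp_all [parityAct, pass, Move.rule, par_star, eq_comm, -Prod.exists,
      -Prod.forall]
    constructor
    · rintro ⟨n, h, h', h''⟩
      exact ⟨h', n, h, h''⟩
    · rintro ⟨h', n, h, h''⟩
      exact ⟨n, h, h', h''⟩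

theorem sound_Γ5 : parityReading.Sound Move.Γ5.rule := by
  refine ⟨_, _, rfl, fun k f u hu => ?_⟩
  match u, hu with
  | a :: b :: u, _ =>
    refine (rel_iff _ _ _ _).2 fun S _ hS => ?_
    simp_all [parityAct, pass, Move.rule, star_self, eq_comm, -Prod.exists,
      -Prod.forall]
    have h : ∀ n, a = star a n ↔ n = a := fun n => eq_comm.trans star_eq_self
    simp only [h]
    constructor
    · rintro ⟨n, h₁, rfl, h₂⟩
      rw [star_self] at h₁
      subst h₁
      exact ⟨rfl, by simpa [hS, star_self] using h₂⟩
    · rintro ⟨rfl, h₂⟩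
      exact ⟨a, (star_self a).symm, rfl, by simpa [hS, star_self] using h₂⟩

theorem sound_Γ6 : parityReading.Sound Move.Γ6.rule := by
  refine ⟨_, _, rfl, fun k f u hu => ?_⟩
  match u, hu with
  | a :: u, _ =>
    refine (rel_iff _ _ _ _).2 fun S _ hS => ?_
    simp_all [parityAct, Move.rule, eq_comm, -Prod.exists,
      -Prod.forall]

theorem sound_Γ6' : parityReading.Sound Move.Γ6'.rule := by
  refine ⟨_, _, rfl, fun k f u hu => ?_⟩
  match u, hu with
  | a :: u, _ =>
    refine (rel_iff _ _ _ _).2 fun S _ hS => ?_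
    simp_all [parityAct, Move.rule, eq_comm, -Prod.exists,
      -Prod.forall]

theorem sound_Γ7 : parityReading.Sound Move.Γ7.rule := by
  refine ⟨_, _, rfl, fun k f u hu => ?_⟩
  match u, hu with
  | a :: b :: c :: u, _ =>
    refine (rel_iff _ _ _ _).2 fun S _ hS => ?_
    simp_all [parityAct, Move.rule, eq_comm, -Prod.exists,
      -Prod.forall]
    constructor <;> rintro ⟨rfl, rfl, h⟩ <;> exact ⟨rfl, rfl, h⟩

theorem sound_Γ8 : parityReading.Sound Move.Γ8.rule := by
  refine ⟨_, _, rfl, fun k f u hu => ?_⟩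
  match u, hu with
  | a :: b :: c :: d :: u, _ =>
    refine (rel_iff _ _ _ _).2 fun S _ hS => ?_
    simp_all [parityAct, pass, Move.rule, star_inj, par_star, eq_comm, -Prod.exists,
      -Prod.forall]
    constructor
    · rintro ⟨n, rfl, rfl, rfl, h⟩
      obtain ⟨h₁, h₂⟩ := exists_star_eq a n
      exact ⟨_, h₁, h₁, rfl, by rwa [← h₁, h₂]⟩
    · rintro ⟨n, rfl, rfl, rfl, h⟩
      obtain ⟨h₁, h₂⟩ := exists_star_eq c n
      exact ⟨_, h₁, h₁, rfl, by rwa [← h₁, h₂]⟩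

/-- Some colouring has colours of both parities. -/
def value (T : List Layer) : Prop :=
  parityReading.ev T ∅ (fun _ S => ∃ a ∈ S, ∃ b ∈ S, a ≠ b) [] ∅

theorem value_applies {ρ : Rule} (h : parityReading.Sound ρ) {D D' : Diagram}
    (hD : Applies ρ D D') : value D.layers = value D'.layers :=
  propext ((rel_iff _ _ _ _).1 (h.applies parityReading hD ∅ _) ∅ le_rfl (by simp))

end parityReading

namespace Move

open Dir Over Marker Piece

theorem parityReading_sound (N : Move) (h : N ≠ Γ2c) (h₃ : N ≠ Γ3) :
    parityReading.Sound N.rule := by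
  cases N <;> first
    | contradiction
    | exact parityReading.sound_Γ1
    | exact parityReading.sound_Γ1'
    | exact parityReading.sound_Γ1a
    | exact parityReading.sound_Γ2
    | exact parityReading.sound_Γ2b
    | exact parityReading.sound_Γ3a
    | exact parityReading.sound_Γ4
    | exact parityReading.sound_Γ4'
    | exact parityReading.sound_Γ5
    | exact parityReading.sound_Γ6
    | exact parityReading.sound_Γ6'
    | exact parityReading.sound_Γ7
    | exact parityReading.sound_Γ8

theorem Γ2c_independentFrom {T : Set Move} (h : Γ2c ∉ T) (h₃ : Γ3 ∉ T) :
    Γ2c.IndependentFrom T := by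
  refine independentFrom_of_invariant (fun D => parityReading.value D.layers)
    (fun ρ hρ _ _ hD => parityReading.value_applies (parityReading.sound_isotopy hρ) hD)
    (fun N hN _ _ hD => parityReading.value_applies (N.parityReading_sound (fun e => h (e ▸ hN))
      (fun e => h₃ (e ▸ hN))) hD)
    [⟨[], cup down, []⟩, ⟨[down], cup up, [up]⟩, ⟨[down, up], cross rising down up, []⟩,
      ⟨[down, up], cross rising up down, []⟩, ⟨[down, up], cross rising down up, []⟩,
      ⟨[], cross rising down up, [up, down]⟩]
    [⟨[up, down], cross falling up down, []⟩, ⟨[up, down], cross falling down up, []⟩,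
      ⟨[], cross falling up down, [up, down]⟩, ⟨[down, up], cross falling up down, []⟩,
      ⟨[down], cap up, [up]⟩, ⟨[], cap down, []⟩] [up] [down] (by decide) (by decide) ?_
  -- The solvability condition imposed by the left side of Γ2c leaves only colourings of one parity;
  -- without it, both parities occur.
  refine fun e => of_eq_false (e.symm.trans (eq_false ?_)) ?_
  · simp [parityReading.value, parityAct, pass, rule, Layer.pad, par_star, -Prod.exists,
      -Prod.forall]
    intro x y z e₁ w e₂ e₃ e₄
    simp only [star, Prod.ext_iff] at e₁ e₂ e₃ e₄
    have hy : par y = par x := by simp only [par]; omega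
    have hz : par z = par x := by simp only [par]; omega
    have hw : par w = par x := by simp only [par]; omega
    simp [hy, hz, hw]
  · simp [parityReading.value, parityAct, pass, rule, par_star, -Prod.exists]
    -- A solution of the crossing equations whose first coordinates include even and odd numbers.
    exact ⟨(0, 0), (-1, 1), (-2, 2), (1, 0), by decide⟩

end Move

end Yoshikawa

open Yoshikawa in
theorem mainTheorem8 :
    (∀ M ∈ S1 \ {Move.Γ5, Move.Γ8}, M.IndependentFrom (S1 \ {M})) ∧
    (∀ M ∈ S2 \ {Move.Γ5, Move.Γ8}, M.IndependentFrom (S2 \ {M})) := by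
  constructor
  · rintro M ⟨hM, hM'⟩
    rcases hM with rfl | rfl | rfl | rfl | rfl | rfl | rfl | rfl | rfl | rfl | rfl
    · exact Move.Γ1_independentFrom (by simp)
    · exact Move.Γ1'_independentFrom (by simp) (by simp [S1])
    · exact Move.Γ2_independentFrom (by simp) (by simp [S1]) (by simp [S1]) (by simp [S1])
    · exact Move.Γ3_independentFrom (by simp) (by simp [S1])
    · exact Move.Γ4_independentFrom (by simp)
    · exact Move.Γ4'_independentFrom (by simp)
    · simp at hM'
    · exact Move.Γ6_independentFrom (by simp)
    · exact Move.Γ6'_independentFrom (by simp)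
    · exact Move.Γ7_independentFrom (by simp)
    · simp at hM'
  · rintro M ⟨hM, hM'⟩
    rcases hM with rfl | rfl | rfl | rfl | rfl | rfl | rfl | rfl | rfl | rfl | rfl | rfl
    · exact Move.Γ1_independentFrom (by simp)
    · exact Move.Γ1a_independentFrom (by simp [S2]) (by simp)
    · exact Move.Γ2b_independentFrom (by simp) (by simp [S2]) (by simp [S2])
    · exact Move.Γ2c_independentFrom (by simp) (by simp [S2])
    · exact Move.Γ3a_independentFrom (by simp [S2]) (by simp)
    · exact Move.Γ4_independentFrom (by simp)
    · exact Move.Γ4'_independentFrom (by simp)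
    · simp at hM'
    · exact Move.Γ6_independentFrom (by simp)
    · exact Move.Γ6'_independentFrom (by simp)
    · exact Move.Γ7_independentFrom (by simp)
    · simp at hM'
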